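/- Let $N\ge 3$ and $0\le\alpha<\beta$. Write $B_r=\{x\in\mathbb{R}^N:|x|<r\}$, let $\Omega=\{x:\alpha<|x|<\beta\}$ if $\alpha>0$ and $\Omega=B_\beta$ if $\alpha=0$, and let $\|u\|_{H^1}^2=\int_\Omega(|\nabla u|^2+u^2)\,dx$. Let $\mathcal C_+$ (resp. $\mathcal C_-$) be the cone of radial functions $u\in H^1(\Omega)$, $u\ge 0$, that are non-decreasing (resp. non-increasing) in $r=|x|$ and continuous on $\overline\Omega$. For $p>1$ and $u\not\equiv 0$ put $Q_p(u)=\|u\|_{H^1}^2/\|u\|_{L^{p+1}(\Omega)}^2$ and $$c_{p,+}=\inf\{Q_p(u):u\in\mathcal C_+,\ u\not\equiv0,\ \|u\|_\infty<\sqrt e+1\},\qquad c_{p,-}=\inf\{Q_p(u):u\in\mathcal C_-,\ u\not\equiv0\}.$$ An increasing solution $u_{p,+}$ is a function $u\in\mathcal C_+$ that solves $-\Delta u+u=u^p$ in $\Omega$, $\partial_\nu u=0$ on $\partial\Omega$, and some positive multiple of which is admissible for and achieves $c_{p,+}$. A decreasing solution $u_{p,-}$ is defined in the same way, with $\mathcal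 C_-$ and $c_{p,-}$. Solutions of boundary value problems are meant in the class $C^2(\Omega)\cap C(\overline\Omega)$, with one-sided normal derivatives on the boundary. (1) The problem $-\Delta u+u=0$ in $\Omega$, $\partial_\nu u=0$ on $\partial B_\alpha$ (no condition there if $\alpha=0$), $u=1$ on $\partial B_\beta$ has a unique solution $u_{\infty,+}$; it belongs to $H^1(\Omega)$, and, as $p\to\infty$, for any choice of the increasing solutions, $u_{p,+}\to u_{\infty,+}$ in $H^1(\Omega)$ and in $C^{0,\gamma}(\overline\Omega)$ for every $\gamma\in(0,1)$. (2) If $\alpha>0$, the problem $-\Delta u+u=0$ in $\Omega$, $\partial_\nu u=0$ on $\partial B_\beta$, $u=1$ on $\partial B_\alpha$ has a unique solution $u_{\infty,-}$; it belongs to $H^1(\Omega)$, and, as $p\to\infty$, for any choice of the decreasing solutions, $u_{p,-}\to u_{\infty,-}$ in $H^1(\Omega)$ and in $C^{0,\gamma}(\overline\Omega)$ for every $\gamma\in(0,1)$. -/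

import Mathlib

open MeasureTheory Filter Topology
open scoped NNReal ENNReal ContDiff Laplacian

noncomputable section

namespace NeumannLayer

/-- The open annulus `B_β ∖ B_α` of `ℝ^N`, with the convention `B_β ∖ B_0 = B_β`. -/
def annulus (N : ℕ) (α β : ℝ) : Set (EuclideanSpace ℝ (Fin N)) :=
  {x | ‖x‖ < β ∧ (0 < α → α < ‖x‖)}

/-- The closure of `B_β ∖ B_α`, for `0 ≤ α < β`. -/
def closedAnnulus (N : ℕ) (α β : ℝ) : Set (EuclideanSpace ℝ (Fin N)) :=
  {x | α ≤ ‖x‖ ∧ ‖x‖ ≤ β}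

/-! ### The Sobolev space `H¹(Ω)` -/

/-- `u` lies in `L²(Ω)` and has the weak gradient `G` in `L²(Ω)`. -/
structure HasWeakGradient {N : ℕ} (Ω : Set (EuclideanSpace ℝ (Fin N)))
    (u : EuclideanSpace ℝ (Fin N) → ℝ)
    (G : EuclideanSpace ℝ (Fin N) → EuclideanSpace ℝ (Fin N)) : Prop where
  memLp : MemLp u 2 (volume.restrict Ω)
  memLp_grad : MemLp G 2 (volume.restrict Ω)
  integral_eq : ∀ φ : EuclideanSpace ℝ (Fin N) → ℝ,
    ContDiff ℝ ∞ φ → HasCompactSupport φ → tsupport φ ⊆ Ω →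
    ∀ v : EuclideanSpace ℝ (Fin N),
      ∫ x in Ω, u x * fderiv ℝ φ x v = - ∫ x in Ω, inner ℝ (G x) v * φ x

/-- `u ∈ H¹(Ω)`. -/
def MemH1 {N : ℕ} (Ω : Set (EuclideanSpace ℝ (Fin N)))
    (u : EuclideanSpace ℝ (Fin N) → ℝ) : Prop :=
  ∃ G, HasWeakGradient Ω u G

open Classical in
/-- The weak gradient of `u ∈ H¹(Ω)` (it is unique almost everywhere in the open set `Ω`). -/
def weakGradient {N : ℕ} (Ω : Set (EuclideanSpace ℝ (Fin N)))
    (u : EuclideanSpace ℝ (Fin N) → ℝ) :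
    EuclideanSpace ℝ (Fin N) → EuclideanSpace ℝ (Fin N) :=
  if h : MemH1 Ω u then h.choose else 0

/-- `‖u‖_{H¹(Ω)}`, for `u ∈ H¹(Ω)`. -/
def h1Norm {N : ℕ} (Ω : Set (EuclideanSpace ℝ (Fin N)))
    (u : EuclideanSpace ℝ (Fin N) → ℝ) : ℝ :=
  √(∫ x in Ω, (‖weakGradient Ω u x‖ ^ 2 + u x ^ 2))

/-! ### The Hölder norm -/

/-- The norm of `C^{0,γ}(K)`: supremum of `|u|` plus the Hölder seminorm (possibly infinite). -/
def holderNorm {N : ℕ} (γ : ℝ≥0) (K : Set (EuclideanSpace ℝ (Fin N)))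
    (u : EuclideanSpace ℝ (Fin N) → ℝ) : ℝ≥0∞ :=
  (⨆ x ∈ K, ‖u x‖ₑ) + eHolderNorm γ (K.domRestrict u)

/-! ### Radial functions and the cones of monotone functions -/

/-- `u ∈ H¹_rad(B_β ∖ B_α)`, given by a representative that is continuous up to the boundary.
Every nonnegative monotone element of the two cones below has such a representative. -/
structure MemH1Rad (N : ℕ) (α β : ℝ) (u : EuclideanSpace ℝ (Fin N) → ℝ) : Prop where
  memH1 : MemH1 (annulus N α β) u
  continuousOn : ContinuousOn u (closedAnnulus N α β)
  radial : ∀ x ∈ closedAnnulus N α β, ∀ y ∈ closedAnnulus N α β, ‖x‖ = ‖y‖ → u x = u y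

/-- The cone of nonnegative, radially nondecreasing functions of `H¹_rad(B_β ∖ B_α)`. -/
def increasingCone (N : ℕ) (α β : ℝ) : Set (EuclideanSpace ℝ (Fin N) → ℝ) :=
  {u | MemH1Rad N α β u ∧ (∀ x ∈ closedAnnulus N α β, 0 ≤ u x) ∧
    ∀ x ∈ closedAnnulus N α β, ∀ y ∈ closedAnnulus N α β, ‖x‖ ≤ ‖y‖ → u x ≤ u y}

/-- The cone of nonnegative, radially nonincreasing functions of `H¹_rad(B_β ∖ B_α)`. -/
def decreasingCone (N : ℕ) (α β : ℝ) : Set (EuclideanSpace ℝ (Fin N) → ℝ) :=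
  {u | MemH1Rad N α β u ∧ (∀ x ∈ closedAnnulus N α β, 0 ≤ u x) ∧
    ∀ x ∈ closedAnnulus N α β, ∀ y ∈ closedAnnulus N α β, ‖x‖ ≤ ‖y‖ → u y ≤ u x}

/-! ### The minimization problems -/

/-- `‖u‖_{L^q(Ω)}`. -/
def lqNorm {N : ℕ} (q : ℝ) (Ω : Set (EuclideanSpace ℝ (Fin N)))
    (u : EuclideanSpace ℝ (Fin N) → ℝ) : ℝ :=
  (∫ x in Ω, |u x| ^ q) ^ (1 / q)

/-- The quotient `Q_p(u) = ‖u‖²_{H¹} / ‖u‖²_{L^{p+1}}` on `B_β ∖ B_α`. -/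
def quotientQ (N : ℕ) (α β p : ℝ) (u : EuclideanSpace ℝ (Fin N) → ℝ) : ℝ :=
  h1Norm (annulus N α β) u ^ 2 / lqNorm (p + 1) (annulus N α β) u ^ 2

/-- Competitors in the increasing case: nonzero elements of the cone with
`‖u‖_∞ < √e + 1` (`u` is continuous on the closed annulus). -/
def increasingCompetitors (N : ℕ) (α β : ℝ) : Set (EuclideanSpace ℝ (Fin N) → ℝ) :=
  {u | u ∈ increasingCone N α β ∧ (∃ x ∈ closedAnnulus N α β, u x ≠ 0) ∧
    ∀ x ∈ closedAnnulus N α β, |u x| < √(Real.exp 1) + 1}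

/-- Competitors in the decreasing case: nonzero elements of the cone. -/
def decreasingCompetitors (N : ℕ) (α β : ℝ) : Set (EuclideanSpace ℝ (Fin N) → ℝ) :=
  {u | u ∈ decreasingCone N α β ∧ ∃ x ∈ closedAnnulus N α β, u x ≠ 0}

/-- The level `c_{p,+}(α, β)`. -/
def levelPlus (N : ℕ) (α β p : ℝ) : ℝ :=
  sInf (quotientQ N α β p '' increasingCompetitors N α β)

/-- The level `c_{p,-}(α, β)`. -/
def levelMinus (N : ℕ) (α β p : ℝ) : ℝ :=
  sInf (quotientQ N α β p '' decreasingCompetitors N α β)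

/-! ### The boundary value problems -/

/-- `∂_ν u = 0` at the boundary point `x ≠ 0` of the annulus: the one-sided derivative of `u` from
inside the closed annulus along the normal line through `x` exists and vanishes. -/
def NormalDerivEqZero (N : ℕ) (α β : ℝ) (u : EuclideanSpace ℝ (Fin N) → ℝ)
    (x : EuclideanSpace ℝ (Fin N)) : Prop :=
  HasLineDerivWithinAt ℝ u 0 (closedAnnulus N α β) x (‖x‖⁻¹ • x)

/-- `u ∈ C²(Ω) ∩ C(closure Ω)` satisfies `-Δu + u = g(u)` in `Ω = B_β ∖ B_α`. -/
structure SolvesEquation (N : ℕ) (α β : ℝ) (g : ℝ → ℝ)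
    (u : EuclideanSpace ℝ (Fin N) → ℝ) : Prop where
  contDiffOn : ContDiffOn ℝ 2 u (annulus N α β)
  continuousOn : ContinuousOn u (closedAnnulus N α β)
  equation : ∀ x ∈ annulus N α β, -(Δ u) x + u x = g (u x)

/-- `-Δu + u = u^p` in `B_β ∖ B_α`, `∂_ν u = 0` on the boundary
(which is `∂B_β` alone if `α = 0`). -/
structure SolvesNeumann (N : ℕ) (α β p : ℝ) (u : EuclideanSpace ℝ (Fin N) → ℝ) : Prop where
  solves : SolvesEquation N α β (fun s => s ^ p) u
  neumann_outer : ∀ x, ‖x‖ = β → NormalDerivEqZero N α β u x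
  neumann_inner : 0 < α → ∀ x, ‖x‖ = α → NormalDerivEqZero N α β u x

/-- `u` is an increasing solution `u_{p,+}(·; α, β)`: it lies in the increasing cone, solves the
Neumann problem, and a positive multiple of it achieves `c_{p,+}(α, β)`. -/
structure IsIncreasingSolution (N : ℕ) (α β p : ℝ)
    (u : EuclideanSpace ℝ (Fin N) → ℝ) : Prop where
  mem_cone : u ∈ increasingCone N α β
  solves : SolvesNeumann N α β p u
  minimal : ∃ t : ℝ, 0 < t ∧ t • u ∈ increasingCompetitors N α β ∧
    quotientQ N α β p (t • u) = levelPlus N α β p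

/-- `u` is a decreasing solution `u_{p,-}(·; α, β)`: it lies in the decreasing cone, solves the
Neumann problem, and a positive multiple of it achieves `c_{p,-}(α, β)`. -/
structure IsDecreasingSolution (N : ℕ) (α β p : ℝ)
    (u : EuclideanSpace ℝ (Fin N) → ℝ) : Prop where
  mem_cone : u ∈ decreasingCone N α β
  solves : SolvesNeumann N α β p u
  minimal : ∃ t : ℝ, 0 < t ∧ t • u ∈ decreasingCompetitors N α β ∧
    quotientQ N α β p (t • u) = levelMinus N α β p

/-- The limit problem `-Δu + u = 0` in `B_β ∖ B_α`, `∂_ν u = 0` on `∂B_α` (no condition if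
`α = 0`), `u = 1` on `∂B_β`. -/
structure SolvesLimitPlus (N : ℕ) (α β : ℝ) (u : EuclideanSpace ℝ (Fin N) → ℝ) : Prop where
  solves : SolvesEquation N α β (fun _ => 0) u
  neumann_inner : 0 < α → ∀ x, ‖x‖ = α → NormalDerivEqZero N α β u x
  dirichlet_outer : ∀ x, ‖x‖ = β → u x = 1

/-- The limit problem `-Δu + u = 0` in `B_β ∖ B_α`, `∂_ν u = 0` on `∂B_β`, `u = 1` on `∂B_α`. -/
structure SolvesLimitMinus (N : ℕ) (α β : ℝ) (u : EuclideanSpace ℝ (Fin N) → ℝ) : Prop where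
  solves : SolvesEquation N α β (fun _ => 0) u
  neumann_outer : ∀ x, ‖x‖ = β → NormalDerivEqZero N α β u x
  dirichlet_inner : ∀ x, ‖x‖ = α → u x = 1

/-- The members of the sets `S p` converge, as `p → ∞` and whatever member of `S p` is taken for
each `p`, to `U` in `H¹(B_β ∖ B_α)` and in `C^{0,γ}` of its closure for every `γ ∈ (0, 1)`. -/
def ConvergesTo (N : ℕ) (α β : ℝ) (S : ℝ → Set (EuclideanSpace ℝ (Fin N) → ℝ))
    (U : EuclideanSpace ℝ (Fin N) → ℝ) : Prop :=
  (∀ ε : ℝ, 0 < ε → ∀ᶠ p in atTop, ∀ u ∈ S p,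
    MemH1 (annulus N α β) (u - U) ∧ h1Norm (annulus N α β) (u - U) < ε) ∧
  ∀ γ : ℝ≥0, 0 < γ → γ < 1 → ∀ ε : ℝ, 0 < ε → ∀ᶠ p in atTop, ∀ u ∈ S p,
    holderNorm γ (closedAnnulus N α β) (u - U) < ENNReal.ofReal ε

end NeumannLayer

end

noncomputable section

namespace NeumannLayer

/-! ### Weak gradients of continuously differentiable functions -/

section WeakGradient

variable {N : ℕ} {Ω : Set (EuclideanSpace ℝ (Fin N))} {u : EuclideanSpace ℝ (Fin N) → ℝ}
  {C : ℝ}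

/-! The limit profile `g` equals `1` at the end `b` where a solution is largest (`b = β` in the
increasing case, `b = α` in the decreasing one), and its flux `r ^ (N - 1) g'` vanishes at the other
end. Let `f` be the profile of a solution and `M = f b` its maximum. Since `f - M g` vanishes at
`b`, Green's formula for `g` says that `f - M g` is `H¹`-orthogonal to `g`. Hence, up to the area of
the sphere, `‖f‖² = M² Λ + D` with `Λ = ‖g‖²` and `D = ‖f - M g‖²`.

Testing the Neumann equation with its own solution gives `X := ‖u‖²_{H¹} = ∫ u ^ (p + 1) ≤ M ^ (p +
1) |Ω|`. Minimality, compared with the competitor `U = g(‖x‖)`, gives `X ^ (1 - 2 / (p + 1)) ≤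
Q_p(U)`, and `Q_p(U) → ‖U‖²_{H¹}` because the `L^{p+1}` norm of `U` tends to `max U = 1`. So
asymptotically `X` is at most `‖U‖²_{H¹}`. Since `M² Λ` is, up to the same area factor, at most `M ^
(p + 1) |Ω|`, the maximum `M` is asymptotically at least `1`. The decomposition then forces `M → 1`
and `D → 0` (`eventually_abs_sub_one_lt`), so `‖f - g‖² = D + (M - 1)² Λ → 0`
(`eventually_energy_lt`). No compactness is used.

For Hölder convergence, integrating the flux equation bounds `|f'|` uniformly in `p`: monotonicity
fixes the sign of `f'`, so only the upper bound `f - f ^ p ≤ M` is needed. A small energy and a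
Lipschitz bound give a small supremum, and interpolation gives the Hölder norm.

The limit profiles come from a power series in `‖x‖ ^ 2`, combined with reduction of order when `α >
0`. Uniqueness among all solutions, radial or not, is a maximum principle
(`nonpos_of_laplacian_eq_self`). -/

theorem continuousOn_fderiv_of_contDiffOn (hΩ : IsOpen Ω) (hu : ContDiffOn ℝ 1 u Ω) :
    ContinuousOn (fderiv ℝ u) Ω :=
  hu.continuousOn_fderiv_of_isOpen hΩ le_rfl

theorem continuousOn_gradient_of_contDiffOn (hΩ : IsOpen Ω) (hu : ContDiffOn ℝ 1 u Ω) :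
    ContinuousOn (gradient u) Ω :=
  (InnerProductSpace.toDual ℝ (EuclideanSpace ℝ (Fin N))).symm.continuous.comp_continuousOn
    (continuousOn_fderiv_of_contDiffOn hΩ hu)

theorem inner_gradient_eq_fderiv (x v : EuclideanSpace ℝ (Fin N)) :
    inner ℝ (gradient u x) v = fderiv ℝ u x v := by
  simp [gradient]

theorem norm_gradient_eq_norm_fderiv (x : EuclideanSpace ℝ (Fin N)) :
    ‖gradient u x‖ = ‖fderiv ℝ u x‖ := by
  simp [gradient]

/-- The integrals over `Ω` equal integrals over the whole space because the test function vanishes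
off `Ω`, so integration by parts has no boundary term. It needs `u` differentiable only on the
support of the test function. -/
theorem hasWeakGradient_gradient (hΩ : IsOpen Ω) (hfin : volume Ω ≠ ⊤)
    (hu : ContDiffOn ℝ 1 u Ω) (hC : ∀ x ∈ Ω, |u x| ≤ C) (hC' : ∀ x ∈ Ω, ‖fderiv ℝ u x‖ ≤ C) :
    HasWeakGradient Ω u (gradient u) := by
  have hfin' : IsFiniteMeasure (volume.restrict Ω) := ⟨by simpa using hfin.lt_top⟩
  refine ⟨?_, ?_, ?_⟩
  · refine MemLp.of_bound (hu.continuousOn.aestronglyMeasurable hΩ.measurableSet) C ?_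
    exact (ae_restrict_iff' hΩ.measurableSet).2 (Eventually.of_forall fun x hx => hC x hx)
  · refine MemLp.of_bound ((continuousOn_gradient_of_contDiffOn hΩ hu).aestronglyMeasurable
      hΩ.measurableSet) C ?_
    refine (ae_restrict_iff' hΩ.measurableSet).2 (Eventually.of_forall fun x hx => ?_)
    rw [norm_gradient_eq_norm_fderiv]
    exact hC' x hx
  · intro φ hφ hφc hφs v
    have hφ0 : ∀ x, x ∉ Ω → φ x = 0 := fun x hx => image_eq_zero_of_notMem_tsupport
      fun h => hx (hφs h)
    have hdφ0 : ∀ x, x ∉ Ω → fderiv ℝ φ x v = 0 := fun x hx => by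
      rw [fderiv_of_notMem_tsupport (𝕜 := ℝ) fun h => hx (hφs h)]; rfl
    have hφcont : Continuous φ := hφ.continuous
    have hdφcont : Continuous fun x => fderiv ℝ φ x v :=
      (hφ.continuous_fderiv (by simp)).clm_apply continuous_const
    have hdφc : HasCompactSupport fun x => fderiv ℝ φ x v :=
      (hφc.fderiv ℝ).comp_left (g := fun L : _ →L[ℝ] ℝ => L v) (by simp)
    obtain ⟨K, hK⟩ := hφc.exists_bound_of_continuous hφcont
    obtain ⟨K', hK'⟩ := hdφc.exists_bound_of_continuous hdφcont
    have key : ∀ a b : EuclideanSpace ℝ (Fin N) → ℝ, ContinuousOn a Ω → Continuous b →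
        ∀ A B, (∀ x ∈ Ω, ‖a x‖ ≤ A) → (∀ x, ‖b x‖ ≤ B) → (∀ x, x ∉ Ω → b x = 0) →
        Integrable fun x => a x * b x := by
      intro a b ha hb A B hA hB h0
      have h1 : IntegrableOn (fun x => a x * b x) Ω := by
        refine IntegrableOn.of_bound hfin.lt_top
          ((ha.mul hb.continuousOn).aestronglyMeasurable hΩ.measurableSet) (A * B) ?_
        refine (ae_restrict_iff' hΩ.measurableSet).2 (Eventually.of_forall fun x hx => ?_)
        rw [norm_mul]
        exact mul_le_mul (hA x hx) (hB x) (norm_nonneg _) ((norm_nonneg _).trans (hA x hx))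
      refine (integrableOn_iff_integrable_of_support_subset fun x hx => ?_).1 h1
      by_contra hx'
      exact hx (by simp [h0 x hx'])
    have hdu : ContinuousOn (fun x => fderiv ℝ u x v) Ω :=
      (continuousOn_fderiv_of_contDiffOn hΩ hu).clm_apply continuousOn_const
    have hdub : ∀ x ∈ Ω, ‖fderiv ℝ u x v‖ ≤ C * ‖v‖ := fun x hx =>
      (ContinuousLinearMap.le_opNorm _ _).trans
        (mul_le_mul_of_nonneg_right (hC' x hx) (norm_nonneg _))
    have main := integral_mul_fderiv_eq_neg_fderiv_mul_of_integrable (μ := volume) (f := u)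
      (g := φ) (v := v) (key _ _ hdu hφcont _ _ hdub hK hφ0)
      (key _ _ hu.continuousOn hdφcont _ _ hC hK' hdφ0)
      (key _ _ hu.continuousOn hφcont _ _ hC hK hφ0)
      (fun x hx => (hu.contDiffAt (hΩ.mem_nhds (hφs hx))).differentiableAt (by simp))
      (fun x _ => hφ.differentiable (by simp) x)
    rw [setIntegral_eq_integral_of_forall_compl_eq_zero fun x hx => by simp [hdφ0 x hx],
      setIntegral_eq_integral_of_forall_compl_eq_zero fun x hx => by simp [hφ0 x hx], main]
    simp_rw [inner_gradient_eq_fderiv]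

/-- `weakGradient` is an arbitrary choice, so norms can be computed classically only after this
uniqueness. It is the fundamental lemma of the calculus of variations, checked against each fixed
vector `v`. -/
theorem HasWeakGradient.ae_eq (hΩ : IsOpen Ω) (hfin : volume Ω ≠ ⊤)
    {G H : EuclideanSpace ℝ (Fin N) → EuclideanSpace ℝ (Fin N)}
    (hG : HasWeakGradient Ω u G) (hH : HasWeakGradient Ω u H) :
    G =ᵐ[volume.restrict Ω] H := by
  have hfin' : IsFiniteMeasure (volume.restrict Ω) := ⟨by simpa using hfin.lt_top⟩
  have hGi : IntegrableOn G Ω := hG.memLp_grad.integrable (by norm_num)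
  have hHi : IntegrableOn H Ω := hH.memLp_grad.integrable (by norm_num)
  have h := hΩ.ae_eq_zero_of_integral_contDiff_smul_eq_zero (μ := volume) (f := G - H)
    (hGi.sub hHi).locallyIntegrableOn ?_
  · rw [EventuallyEq, ae_restrict_iff' hΩ.measurableSet]
    filter_upwards [h] with x hx hxΩ
    exact sub_eq_zero.1 (hx hxΩ)
  · intro φ hφ hφc hφs
    have hφ0 : ∀ x, x ∉ Ω → φ x = 0 := fun x hx => image_eq_zero_of_notMem_tsupport
      fun h => hx (hφs h)
    obtain ⟨K, hK⟩ := hφc.exists_bound_of_continuous hφ.continuous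
    have hint : ∀ F : EuclideanSpace ℝ (Fin N) → EuclideanSpace ℝ (Fin N), IntegrableOn F Ω →
        IntegrableOn (fun x => φ x • F x) Ω := fun F hF =>
      hF.bdd_smul (φ := φ) K hφ.continuous.aestronglyMeasurable (Eventually.of_forall hK)
    rw [← setIntegral_eq_integral_of_forall_compl_eq_zero (s := Ω)
      fun x hx => by simp [hφ0 x hx]]
    refine ext_inner_right ℝ fun v => ?_
    have e : ∀ F : EuclideanSpace ℝ (Fin N) → EuclideanSpace ℝ (Fin N), IntegrableOn F Ω →
        inner ℝ (∫ x in Ω, φ x • F x) v = ∫ x in Ω, inner ℝ (F x) v * φ x := by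
      intro F hF
      rw [real_inner_comm, ← integral_inner (hint F hF)]
      refine integral_congr_ae (Eventually.of_forall fun x => ?_)
      simp only [inner_smul_right, real_inner_comm v]
      ring
    have e2 : (∫ x in Ω, φ x • (G - H) x) = (∫ x in Ω, φ x • G x) - ∫ x in Ω, φ x • H x := by
      rw [← integral_sub (hint G hGi) (hint H hHi)]
      simp [smul_sub]
    rw [e2, inner_sub_left, e G hGi, e H hHi]
    have h1 := hG.integral_eq φ hφ hφc hφs v
    have h2 := hH.integral_eq φ hφ hφc hφs v
    simp only [inner_zero_left]
    linarith

theorem h1Norm_sq_eq_integral (hΩ : IsOpen Ω) (hfin : volume Ω ≠ ⊤)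
    (hu : ContDiffOn ℝ 1 u Ω) (hC : ∀ x ∈ Ω, |u x| ≤ C) (hC' : ∀ x ∈ Ω, ‖fderiv ℝ u x‖ ≤ C) :
    h1Norm Ω u ^ 2 = ∫ x in Ω, (‖fderiv ℝ u x‖ ^ 2 + u x ^ 2) := by
  have hw := hasWeakGradient_gradient hΩ hfin hu hC hC'
  have hmem : MemH1 Ω u := ⟨_, hw⟩
  have hch : HasWeakGradient Ω u (weakGradient Ω u) := by
    rw [weakGradient, dif_pos hmem]
    exact hmem.choose_spec
  rw [h1Norm, Real.sq_sqrt (integral_nonneg fun x => by positivity)]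
  refine integral_congr_ae ?_
  filter_upwards [hch.ae_eq hΩ hfin hw] with x hx
  rw [hx, norm_gradient_eq_norm_fderiv]

end WeakGradient

/-! ### Annuli and polar coordinates -/

section Annulus

variable {N : ℕ} {α β : ℝ}

theorem isOpen_annulus : IsOpen (annulus N α β) := by
  rw [annulus, Set.ofPred_and]
  refine (isOpen_lt continuous_norm continuous_const).inter ?_
  by_cases h : 0 < α
  · simpa [h] using isOpen_lt continuous_const continuous_norm
  · simp [h]

theorem isCompact_closedAnnulus : IsCompact (closedAnnulus N α β) := by
  refine (isCompact_closedBall (0 : EuclideanSpace ℝ (Fin N)) β).of_isClosed_subset ?_ ?_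
  · exact (isClosed_le continuous_const continuous_norm).inter
      (isClosed_le continuous_norm continuous_const)
  · intro x hx
    simpa using hx.2

theorem annulus_subset_closedAnnulus (hα : 0 ≤ α) : annulus N α β ⊆ closedAnnulus N α β := by
  intro x hx
  refine ⟨?_, hx.1.le⟩
  rcases hα.eq_or_lt with h | h
  · exact h ▸ norm_nonneg x
  · exact (hx.2 h).le

theorem volume_annulus_ne_top : volume (annulus N α β) ≠ ⊤ := by
  refine ((measure_mono ?_).trans_lt (measure_ball_lt_top (x := (0 : EuclideanSpace ℝ (Fin N)))
    (r := β))).ne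
  intro x hx
  simpa using hx.1

theorem mem_annulus_of_norm_mem_Ioo {x : EuclideanSpace ℝ (Fin N)} (h : ‖x‖ ∈ Set.Ioo α β) :
    x ∈ annulus N α β :=
  ⟨h.2, fun _ => h.1⟩

theorem norm_mem_Ioo_of_mem_annulus (hα : 0 ≤ α) {x : EuclideanSpace ℝ (Fin N)}
    (h : x ∈ annulus N α β) (hx : x ≠ 0) : ‖x‖ ∈ Set.Ioo α β := by
  refine ⟨?_, h.1⟩
  rcases hα.eq_or_lt with hzero | hpos
  · exact hzero ▸ norm_pos_iff.2 hx
  · exact h.2 hpos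

/-- The area of the unit sphere of `ℝ^N`. -/
def sphereArea (N : ℕ) : ℝ :=
  N * volume.real (Metric.ball (0 : EuclideanSpace ℝ (Fin N)) 1)

theorem sphereArea_pos (hN : 0 < N) : 0 < sphereArea N := by
  have : 0 < volume.real (Metric.ball (0 : EuclideanSpace ℝ (Fin N)) 1) :=
    ENNReal.toReal_pos (Metric.measure_ball_pos volume _ one_pos).ne' measure_ball_lt_top.ne
  have hN' : (0 : ℝ) < N := by exact_mod_cast hN
  exact mul_pos hN' this

theorem integral_annulus_comp_norm (hN : 0 < N) (hα : 0 ≤ α) (hαβ : α ≤ β) (F : ℝ → ℝ) :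
    ∫ x in annulus N α β, F ‖x‖ = sphereArea N * ∫ r in α..β, r ^ (N - 1) * F r := by
  have : Nonempty (Fin N) := ⟨⟨0, hN⟩⟩
  -- For `α = 0` the two sets differ by the origin only.
  have hae : annulus N α β =ᵐ[volume]
      (fun x : EuclideanSpace ℝ (Fin N) => ‖x‖) ⁻¹' Set.Ioo α β := by
    have h0 : ∀ᵐ x : EuclideanSpace ℝ (Fin N), x ≠ 0 := Measure.ae_ne volume 0
    filter_upwards [h0] with x hx
    exact propext ⟨fun h => norm_mem_Ioo_of_mem_annulus hα h hx, mem_annulus_of_norm_mem_Ioo⟩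
  have hm : MeasurableSet ((fun x : EuclideanSpace ℝ (Fin N) => ‖x‖) ⁻¹' Set.Ioo α β) :=
    measurable_norm measurableSet_Ioo
  rw [setIntegral_congr_set hae, ← integral_indicator hm]
  have h1 : (fun x : EuclideanSpace ℝ (Fin N) =>
      ((fun x => ‖x‖) ⁻¹' Set.Ioo α β).indicator (fun x => F ‖x‖) x) =
      fun x => (Set.Ioo α β).indicator F ‖x‖ := by
    ext x
    simp [Set.indicator]
  have h2 : ∫ y in Set.Ioi (0 : ℝ), y ^ (N - 1) • (Set.Ioo α β).indicator F y =
      ∫ y in Set.Ioo α β, y ^ (N - 1) * F y := by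
    have h3 : (fun y : ℝ => y ^ (N - 1) • (Set.Ioo α β).indicator F y) =
        (Set.Ioo α β).indicator fun y => y ^ (N - 1) * F y := by
      ext y
      by_cases hy : y ∈ Set.Ioo α β <;> simp [Set.indicator, hy]
    have h4 : Set.Ioo α β ⊆ Set.Ioi 0 := fun y hy => lt_of_le_of_lt hα hy.1
    rw [h3, setIntegral_indicator measurableSet_Ioo, Set.inter_eq_right.2 h4]
  rw [h1, integral_fun_norm_addHaar, finrank_euclideanSpace_fin, h2, sphereArea,
    intervalIntegral.integral_of_le hαβ, integral_Ioc_eq_integral_Ioo, nsmul_eq_mul, smul_eq_mul,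
    mul_assoc]

end Annulus

/-! ### The Laplacian of a radial function -/

section RadialLaplacian

variable {N : ℕ}

theorem laplacian_eq_sum_fderiv_fderiv (u : EuclideanSpace ℝ (Fin N) → ℝ)
    (x : EuclideanSpace ℝ (Fin N)) :
    (Δ u) x = ∑ i, fderiv ℝ (fderiv ℝ u) x (EuclideanSpace.basisFun (Fin N) ℝ i)
      (EuclideanSpace.basisFun (Fin N) ℝ i) := by
  rw [InnerProductSpace.laplacian_eq_iteratedFDeriv_orthonormalBasis u
    (EuclideanSpace.basisFun (Fin N) ℝ)]
  simp [iteratedFDeriv_two_apply]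

/-- The variable `s = ‖x‖ ^ 2` is smooth at the origin, so the formula also holds at `x = 0`. This
is what the ball case needs. -/
theorem laplacian_comp_norm_sq {h h' : ℝ → ℝ} {h'' : ℝ} {x : EuclideanSpace ℝ (Fin N)}
    (hh : ∀ᶠ s in 𝓝 (‖x‖ ^ 2), HasDerivAt h (h' s) s) (hh' : HasDerivAt h' h'' (‖x‖ ^ 2)) :
    (Δ fun y : EuclideanSpace ℝ (Fin N) => h (‖y‖ ^ 2)) x =
      2 * N * h' (‖x‖ ^ 2) + 4 * ‖x‖ ^ 2 * h'' := by
  have hsq : ∀ y : EuclideanSpace ℝ (Fin N),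
      HasFDerivAt (fun y : EuclideanSpace ℝ (Fin N) => ‖y‖ ^ 2) ((2 : ℝ) • innerSL ℝ y) y :=
    fun y => by
      have := (hasStrictFDerivAt_norm_sq y).hasFDerivAt
      rwa [← Nat.cast_smul_eq_nsmul ℝ 2, Nat.cast_ofNat] at this
  have hc : Tendsto (fun y : EuclideanSpace ℝ (Fin N) => ‖y‖ ^ 2) (𝓝 x) (𝓝 (‖x‖ ^ 2)) :=
    (continuous_norm.pow 2).continuousAt
  have h1 : fderiv ℝ (fun y : EuclideanSpace ℝ (Fin N) => h (‖y‖ ^ 2)) =ᶠ[𝓝 x]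
      fun y => h' (‖y‖ ^ 2) • ((2 : ℝ) • innerSL ℝ y) := by
    filter_upwards [hc.eventually hh] with y hy
    exact (hy.comp_hasFDerivAt y (hsq y)).fderiv
  have h2 : HasFDerivAt (fun y : EuclideanSpace ℝ (Fin N) => h' (‖y‖ ^ 2))
      (h'' • ((2 : ℝ) • innerSL ℝ x)) x := hh'.comp_hasFDerivAt x (hsq x)
  have h3 : HasFDerivAt (fun y : EuclideanSpace ℝ (Fin N) => (2 : ℝ) • innerSL ℝ y)
      ((2 : ℝ) • innerSL ℝ : EuclideanSpace ℝ (Fin N) →L[ℝ] _) x :=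
    ((2 : ℝ) • innerSL ℝ : EuclideanSpace ℝ (Fin N) →L[ℝ] _).hasFDerivAt
  have h4 : fderiv ℝ (fun y : EuclideanSpace ℝ (Fin N) => h' (‖y‖ ^ 2) • ((2 : ℝ) • innerSL ℝ y)) x
      = _ := (h2.smul h3).fderiv
  rw [laplacian_eq_sum_fderiv_fderiv, h1.fderiv_eq]
  have h5 : ∀ i, fderiv ℝ (fun y : EuclideanSpace ℝ (Fin N) =>
      h' (‖y‖ ^ 2) • ((2 : ℝ) • innerSL ℝ y)) x (EuclideanSpace.basisFun (Fin N) ℝ i)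
      (EuclideanSpace.basisFun (Fin N) ℝ i) = 2 * h' (‖x‖ ^ 2) + 4 * h'' * x i ^ 2 := by
    intro i
    rw [h4]
    have h6 :
        innerSL ℝ (EuclideanSpace.single i (1 : ℝ)) (EuclideanSpace.single i (1 : ℝ)) = 1 := by
      rw [innerSL_apply_apply]
      simp
    simp [EuclideanSpace.inner_single_right, h6]
    ring
  rw [Finset.sum_congr rfl fun i _ => h5 i, Finset.sum_add_distrib, Finset.sum_const,
    Finset.card_univ, Fintype.card_fin, ← Finset.mul_sum, nsmul_eq_mul,
    ← EuclideanSpace.real_norm_sq_eq]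
  ring

theorem laplacian_comp_norm {f f' : ℝ → ℝ} {f'' : ℝ} {x : EuclideanSpace ℝ (Fin N)} (hx : x ≠ 0)
    (hf : ∀ᶠ r in 𝓝 ‖x‖, HasDerivAt f (f' r) r) (hf' : HasDerivAt f' f'' ‖x‖) :
    (Δ fun y : EuclideanSpace ℝ (Fin N) => f ‖y‖) x = f'' + (N - 1) / ‖x‖ * f' ‖x‖ := by
  have hr : 0 < ‖x‖ := norm_pos_iff.2 hx
  have hs : √(‖x‖ ^ 2) = ‖x‖ := Real.sqrt_sq hr.le
  have hpos : ∀ᶠ s in 𝓝 (‖x‖ ^ 2), 0 < s := lt_mem_nhds (by positivity)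
  have hsq : Tendsto Real.sqrt (𝓝 (‖x‖ ^ 2)) (𝓝 ‖x‖) := by
    have := Real.continuous_sqrt.tendsto (‖x‖ ^ 2)
    rwa [hs] at this
  have h1 : ∀ᶠ s in 𝓝 (‖x‖ ^ 2),
      HasDerivAt (fun s => f √s) (f' √s * (1 / (2 * √s))) s := by
    filter_upwards [hpos, hsq.eventually hf] with s hs0 hs1
    exact hs1.comp s (Real.hasDerivAt_sqrt hs0.ne')
  have h0 : HasDerivAt Real.sqrt (1 / (2 * ‖x‖)) (‖x‖ ^ 2) := by
    have := Real.hasDerivAt_sqrt (x := ‖x‖ ^ 2) (by positivity)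
    rwa [hs] at this
  have h2 : HasDerivAt (fun s => f' √s * (1 / (2 * √s)))
      (f'' * (1 / (2 * ‖x‖)) * (1 / (2 * ‖x‖)) +
        f' ‖x‖ * ((0 * (2 * ‖x‖) - 1 * (2 * (1 / (2 * ‖x‖)))) / (2 * ‖x‖) ^ 2)) (‖x‖ ^ 2) := by
    have a : HasDerivAt (fun s => f' √s) (f'' * (1 / (2 * ‖x‖))) (‖x‖ ^ 2) :=
      HasDerivAt.comp (h₂ := f') (‖x‖ ^ 2) (by rwa [hs]) h0
    have b := (hasDerivAt_const (‖x‖ ^ 2) (1 : ℝ)).div (h0.const_mul 2)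
      (by rw [hs]; positivity)
    refine (a.mul b).congr_deriv ?_
    simp only [Pi.div_apply, hs]
  have h3 := laplacian_comp_norm_sq (x := x) h1 h2
  simp only [Real.sqrt_sq (norm_nonneg _)] at h3
  rw [h3]
  field_simp
  ring

/-- If the second derivative along `v` were positive, the restriction of `u` to the line would also
have a local minimum at `x`. It would then be locally constant, with zero second derivative. -/
theorem fderiv_fderiv_apply_nonpos_of_isLocalMax {u : EuclideanSpace ℝ (Fin N) → ℝ}
    {x : EuclideanSpace ℝ (Fin N)} (hu : ContDiffAt ℝ 2 u x) (hmax : IsLocalMax u x)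
    (v : EuclideanSpace ℝ (Fin N)) : fderiv ℝ (fderiv ℝ u) x v v ≤ 0 := by
  by_contra! hpos
  have hline : ∀ t : ℝ, HasDerivAt (fun t : ℝ => x + t • v) v t := fun t => by
    simpa using ((hasDerivAt_id t).smul_const v).const_add x
  have hcont : Tendsto (fun t : ℝ => x + t • v) (𝓝 0) (𝓝 x) := by
    have := (hline 0).continuousAt.tendsto
    simpa using this
  have hd1 : ∀ᶠ t in 𝓝 (0 : ℝ),
      HasDerivAt (fun t : ℝ => u (x + t • v)) (fderiv ℝ u (x + t • v) v) t := by
    have : ∀ᶠ y in 𝓝 x, DifferentiableAt ℝ u y := by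
      filter_upwards [hu.eventually (by simp)] with y hy
      exact hy.differentiableAt (by simp)
    filter_upwards [hcont.eventually this] with t ht
    exact ht.hasFDerivAt.comp_hasDerivAt t (hline t)
  have hd2 : HasDerivAt (fun t : ℝ => fderiv ℝ u (x + t • v) v)
      (fderiv ℝ (fderiv ℝ u) x v v) 0 := by
    have h1 : DifferentiableAt ℝ (fderiv ℝ u) x :=
      (hu.fderiv_right (m := 1) (by norm_num)).differentiableAt (by simp)
    have h2 : HasDerivAt (fun t : ℝ => fderiv ℝ u (x + t • v)) (fderiv ℝ (fderiv ℝ u) x v) 0 :=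
      HasFDerivAt.comp_hasDerivAt (l := fderiv ℝ u) (0 : ℝ) (by simpa using h1.hasFDerivAt)
        (hline 0)
    exact h2.clm_apply (hasDerivAt_const 0 v) |>.congr_deriv (by simp)
  have hderiv : deriv (fun t : ℝ => u (x + t • v)) =ᶠ[𝓝 0]
      fun t => fderiv ℝ u (x + t • v) v := hd1.mono fun t ht => ht.deriv
  have hdd : deriv (deriv fun t : ℝ => u (x + t • v)) 0 = fderiv ℝ (fderiv ℝ u) x v v := by
    rw [hderiv.deriv_eq, hd2.deriv]
  have hmax' : ∀ᶠ t in 𝓝 (0 : ℝ), u (x + t • v) ≤ u (x + (0 : ℝ) • v) := by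
    filter_upwards [hcont.eventually hmax] with t ht
    simpa using ht
  have hmin := isLocalMin_of_deriv_deriv_pos (hdd ▸ hpos)
    (IsLocalMax.deriv_eq_zero hmax') hd1.self_of_nhds.continuousAt
  have hconst : (fun t : ℝ => u (x + t • v)) =ᶠ[𝓝 0] fun _ => u (x + (0 : ℝ) • v) := by
    filter_upwards [hmax', hmin] with t h1 h2 using le_antisymm h1 h2
  have h0 : deriv (deriv fun t : ℝ => u (x + t • v)) 0 = 0 := by
    rw [hconst.deriv.deriv_eq]
    simp
  linarith

theorem laplacian_nonpos_of_isLocalMax {u : EuclideanSpace ℝ (Fin N) → ℝ}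
    {x : EuclideanSpace ℝ (Fin N)} (hu : ContDiffAt ℝ 2 u x) (hmax : IsLocalMax u x) :
    (Δ u) x ≤ 0 := by
  rw [laplacian_eq_sum_fderiv_fderiv]
  exact Finset.sum_nonpos fun i _ => fderiv_fderiv_apply_nonpos_of_isLocalMax hu hmax _

end RadialLaplacian

/-! ### Uniqueness for the limit problems -/

section Uniqueness

variable {N : ℕ} {α β : ℝ}

theorem nonpos_deriv_of_right_max {ψ : ℝ → ℝ} {d δ : ℝ} (hδ : 0 < δ)
    (hψ : HasDerivWithinAt ψ d (Set.Icc 0 δ) 0) (hmax : ∀ s ∈ Set.Icc 0 δ, ψ s ≤ ψ 0) : d ≤ 0 := by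
  have h1 : HasDerivWithinAt ψ d (Set.Ioc 0 δ) 0 := hψ.mono Set.Ioc_subset_Icc_self
  rw [hasDerivWithinAt_iff_tendsto_slope' (by simp)] at h1
  have : (𝓝[Set.Ioc 0 δ] (0 : ℝ)).NeBot := left_nhdsWithin_Ioc_neBot hδ
  refine le_of_tendsto h1 ?_
  filter_upwards [self_mem_nhdsWithin] with s hs
  rw [slope_def_field]
  exact div_nonpos_of_nonpos_of_nonneg (by linarith [hmax s ⟨hs.1.le, hs.2⟩]) (by linarith [hs.1])

/-- A maximum principle for `Δw = w` with mixed boundary conditions: each boundary point is of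
Dirichlet type, or of Neumann type with the inward normal pointing along `τ x`, `τ = ± 1`. -/
theorem nonpos_of_laplacian_eq_self {w : EuclideanSpace ℝ (Fin N) → ℝ} {τ : ℝ} (hτ : τ ^ 2 = 1)
    (hw2 : ContDiffOn ℝ 2 w (annulus N α β)) (hwc : ContinuousOn w (closedAnnulus N α β))
    (hw : ∀ x ∈ annulus N α β, (Δ w) x = w x)
    (hbd : ∀ x ∈ closedAnnulus N α β, x ∉ annulus N α β → w x = 0 ∨ 0 < ‖x‖ ∧
      NormalDerivEqZero N α β w x ∧ ∃ δ > 0, ∀ s ∈ Set.Icc 0 δ, ‖x‖ + τ * s ∈ Set.Icc α β)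
    (hα : 0 ≤ α) : ∀ x ∈ closedAnnulus N α β, w x ≤ 0 := by
  intro x hx
  have hτ1 : |τ| = 1 := by
    rw [← sq_eq_sq₀ (abs_nonneg _) zero_le_one, sq_abs, hτ, one_pow]
  -- The term `2 N ε` is the Laplacian of the perturbation below. Its size `ε β ²` is paid twice, at
  -- `x` and at the maximum point.
  have key : ∀ ε : ℝ, 0 < ε → w x ≤ ε * (2 * N + 2 * β ^ 2) := by
    intro ε hε
    -- The added term has derivative `2 ε ‖y‖ > 0` in the inward direction `τ y / ‖y‖`, because `τ ^
    -- 2 = 1`. At a Neumann point `w` contributes zero, so `z` increases inwards and has no maximum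
    -- there.
    set z : EuclideanSpace ℝ (Fin N) → ℝ := fun y => w y + ε * τ * ‖y‖ ^ 2 with hz
    have hgc : ContDiff ℝ 2 fun y : EuclideanSpace ℝ (Fin N) => ε * τ * ‖y‖ ^ 2 :=
      contDiff_const.mul (contDiff_norm_sq ℝ)
    have hzc : ContinuousOn z (closedAnnulus N α β) := hwc.add hgc.continuous.continuousOn
    obtain ⟨y, hy, hymax⟩ := isCompact_closedAnnulus.exists_isMaxOn ⟨x, hx⟩ hzc
    have hsq : ∀ v ∈ closedAnnulus N α β, |ε * τ * ‖v‖ ^ 2| ≤ ε * β ^ 2 := by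
      intro v hv
      rw [abs_mul, abs_mul, hτ1, abs_of_pos hε, mul_one, abs_of_nonneg (sq_nonneg _)]
      have := hv.2
      gcongr
    have hzx : z x ≤ z y := hymax hx
    have hzx' : w x ≤ z y + ε * β ^ 2 := by
      have h1 := neg_abs_le (ε * τ * ‖x‖ ^ 2)
      have h2 := hsq x hx
      simp only [hz] at hzx ⊢
      linarith
    have h3 := le_abs_self (ε * τ * ‖y‖ ^ 2)
    have h4 := hsq y hy
    have hN0 : 0 ≤ ε * N := by positivity
    by_cases hyΩ : y ∈ annulus N α β
    · have hnh : annulus N α β ∈ 𝓝 y := isOpen_annulus.mem_nhds hyΩ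
      have hw2y : ContDiffAt ℝ 2 w y := hw2.contDiffAt hnh
      have hloc : IsLocalMax z y :=
        hymax.isLocalMax (mem_of_superset hnh (annulus_subset_closedAnnulus hα))
      have hlap := laplacian_nonpos_of_isLocalMax (hw2y.add hgc.contDiffAt) hloc
      have hlg : (Δ fun y : EuclideanSpace ℝ (Fin N) => ε * τ * ‖y‖ ^ 2) y = 2 * N * (ε * τ) := by
        rw [laplacian_comp_norm_sq (h := fun s => ε * τ * s) (h' := fun _ => ε * τ) (h'' := 0)
          (Eventually.of_forall fun s => by simpa using (hasDerivAt_id s).const_mul (ε * τ))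
          (hasDerivAt_const _ _)]
        ring
      have hadd : (Δ fun v => w v + ε * τ * ‖v‖ ^ 2) y = _ := hw2y.laplacian_add hgc.contDiffAt
      rw [hadd, hlg, hw y hyΩ] at hlap
      have h5 : |2 * N * (ε * τ)| = 2 * N * ε := by
        rw [abs_mul, abs_mul ε, hτ1, abs_of_pos hε, mul_one, abs_of_nonneg (by positivity)]
      have h6 := neg_abs_le (2 * N * (ε * τ))
      simp only [hz] at hzx'
      nlinarith
    · rcases hbd y hy hyΩ with h0 | ⟨hypos, hyN, δ, hδ, hin⟩
      · simp only [hz] at hzx'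
        rw [h0] at hzx'
        nlinarith
      · exfalso
        set ν := ‖y‖⁻¹ • y with hν
        have hline : ∀ t : ℝ, y + t • ν = ((‖y‖ + t) / ‖y‖) • y := fun t => by
          rw [hν, smul_smul, add_div, div_self hypos.ne', add_smul, one_smul, div_eq_mul_inv]
        have hnorm : ∀ s ∈ Set.Icc 0 δ, ‖y + (τ * s) • ν‖ = ‖y‖ + τ * s := fun s hs => by
          rw [hline, norm_smul, Real.norm_eq_abs, abs_div, abs_of_pos hypos,
            div_mul_cancel₀ _ hypos.ne', abs_of_nonneg (hα.trans (hin s hs).1)]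
        have hmaps : Set.MapsTo (fun s => τ * s) (Set.Icc 0 δ)
            ((fun t : ℝ => y + t • ν) ⁻¹' closedAnnulus N α β) := fun s hs => by
          change α ≤ ‖y + (τ * s) • ν‖ ∧ ‖y + (τ * s) • ν‖ ≤ β
          rw [hnorm s hs]
          exact hin s hs
        have hτs : HasDerivWithinAt (fun s : ℝ => τ * s) τ (Set.Icc 0 δ) 0 := by
          simpa using ((hasDerivAt_id (0 : ℝ)).const_mul τ).hasDerivWithinAt
        have hd1 : HasDerivWithinAt (fun s => w (y + (τ * s) • ν)) 0 (Set.Icc 0 δ) 0 := by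
          have h7 : HasDerivWithinAt (fun t : ℝ => w (y + t • ν)) 0
              ((fun t : ℝ => y + t • ν) ⁻¹' closedAnnulus N α β) (τ * 0) := by
            rw [mul_zero]
            exact hyN
          exact (h7.comp 0 hτs hmaps).congr_deriv (by simp)
        have hd2 : HasDerivWithinAt (fun s => ε * τ * (‖y‖ + τ * s) ^ 2) (2 * ε * ‖y‖)
            (Set.Icc 0 δ) 0 := by
          refine (((hτs.const_add ‖y‖).pow 2).const_mul (ε * τ)).congr_deriv ?_
          simp only [mul_zero, add_zero]
          linear_combination (2 * ε * ‖y‖) * hτ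
        have hd := nonpos_deriv_of_right_max hδ (hd1.add hd2) (fun s hs => by
          have h8 : z (y + (τ * s) • ν) ≤ z y := hymax (hmaps hs)
          simp only [hz, hnorm s hs] at h8
          simpa using h8)
        have : 0 < 2 * ε * ‖y‖ := by positivity
        linarith
  refine le_of_forall_pos_le_add fun η hη => ?_
  have hpos : 0 < 2 * (N : ℝ) + 2 * β ^ 2 + 1 := by positivity
  have := key (η / (2 * N + 2 * β ^ 2 + 1)) (by positivity)
  rw [zero_add]
  refine this.trans ?_
  rw [div_mul_eq_mul_div, div_le_iff₀ hpos]
  nlinarith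

theorem NormalDerivEqZero.sub {u v : EuclideanSpace ℝ (Fin N) → ℝ} {x : EuclideanSpace ℝ (Fin N)}
    (hu : NormalDerivEqZero N α β u x) (hv : NormalDerivEqZero N α β v x) :
    NormalDerivEqZero N α β (u - v) x := by
  have := HasDerivWithinAt.sub hu hv
  simp only [sub_zero] at this
  exact this

theorem laplacian_sub_eq_self {u v : EuclideanSpace ℝ (Fin N) → ℝ}
    (hu : SolvesEquation N α β (fun _ => 0) u) (hv : SolvesEquation N α β (fun _ => 0) v) :
    ∀ x ∈ annulus N α β, (Δ (u - v)) x = (u - v) x := by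
  intro x hx
  have hnh : annulus N α β ∈ 𝓝 x := isOpen_annulus.mem_nhds hx
  rw [(hu.contDiffOn.contDiffAt hnh).laplacian_sub (hv.contDiffOn.contDiffAt hnh), Pi.sub_apply]
  linarith [hu.equation x hx, hv.equation x hx]

theorem norm_eq_of_mem_closedAnnulus_of_notMem_annulus {x : EuclideanSpace ℝ (Fin N)}
    (hx : x ∈ closedAnnulus N α β) (hx' : x ∉ annulus N α β) :
    ‖x‖ = β ∨ 0 < α ∧ ‖x‖ = α := by
  by_contra! h
  exact hx' ⟨lt_of_le_of_ne hx.2 h.1, fun h0 => lt_of_le_of_ne hx.1 (h.2 h0).symm⟩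

/-- The Neumann points lie on the inner sphere, where the inward direction points away from the
origin, so `τ = 1`. The decreasing case takes `τ = -1` on the outer sphere. -/
theorem SolvesLimitPlus.le {u v : EuclideanSpace ℝ (Fin N) → ℝ} (hα : 0 ≤ α) (hαβ : α < β)
    (hu : SolvesLimitPlus N α β u) (hv : SolvesLimitPlus N α β v) :
    ∀ x ∈ closedAnnulus N α β, u x ≤ v x := by
  intro x hx
  have := nonpos_of_laplacian_eq_self (τ := 1) (by norm_num)
    (hu.solves.contDiffOn.sub hv.solves.contDiffOn)
    (hu.solves.continuousOn.sub hv.solves.continuousOn)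
    (laplacian_sub_eq_self hu.solves hv.solves) (fun y hy hy' => ?_) hα x hx
  · simpa using this
  · rcases norm_eq_of_mem_closedAnnulus_of_notMem_annulus hy hy' with h | ⟨h0, h⟩
    · left
      simp [hu.dirichlet_outer y h, hv.dirichlet_outer y h]
    · exact Or.inr ⟨h ▸ h0, (hu.neumann_inner h0 y h).sub (hv.neumann_inner h0 y h), β - α,
        sub_pos.2 hαβ, fun s hs => by rw [h]; exact ⟨by linarith [hs.1], by linarith [hs.2]⟩⟩

theorem SolvesLimitMinus.le {u v : EuclideanSpace ℝ (Fin N) → ℝ} (hα : 0 < α) (hαβ : α < β)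
    (hu : SolvesLimitMinus N α β u) (hv : SolvesLimitMinus N α β v) :
    ∀ x ∈ closedAnnulus N α β, u x ≤ v x := by
  intro x hx
  have := nonpos_of_laplacian_eq_self (τ := -1) (by norm_num)
    (hu.solves.contDiffOn.sub hv.solves.contDiffOn)
    (hu.solves.continuousOn.sub hv.solves.continuousOn)
    (laplacian_sub_eq_self hu.solves hv.solves) (fun y hy hy' => ?_) hα.le x hx
  · simpa using this
  · rcases norm_eq_of_mem_closedAnnulus_of_notMem_annulus hy hy' with h | ⟨h0, h⟩
    · exact Or.inr ⟨h ▸ hα.trans hαβ, (hu.neumann_outer y h).sub (hv.neumann_outer y h), β - α,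
        sub_pos.2 hαβ, fun s hs => by rw [h]; exact ⟨by linarith [hs.2], by linarith [hs.1]⟩⟩
    · left
      simp [hu.dirichlet_inner y h, hv.dirichlet_inner y h]

theorem SolvesLimitPlus.eqOn {u v : EuclideanSpace ℝ (Fin N) → ℝ} (hα : 0 ≤ α) (hαβ : α < β)
    (hu : SolvesLimitPlus N α β u) (hv : SolvesLimitPlus N α β v) :
    Set.EqOn u v (closedAnnulus N α β) := fun x hx =>
  le_antisymm (hu.le hα hαβ hv x hx) (hv.le hα hαβ hu x hx)

theorem SolvesLimitMinus.eqOn {u v : EuclideanSpace ℝ (Fin N) → ℝ} (hα : 0 < α) (hαβ : α < β)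
    (hu : SolvesLimitMinus N α β u) (hv : SolvesLimitMinus N α β v) :
    Set.EqOn u v (closedAnnulus N α β) := fun x hx =>
  le_antisymm (hu.le hα hαβ hv x hx) (hv.le hα hαβ hu x hx)

end Uniqueness

/-! ### The regular radial solution of `Δu = u` as a power series in `‖x‖ ^ 2` -/

section PowerSeries

theorem summable_of_abs_le_inv_factorial {a : ℕ → ℝ} (ha : ∀ k, |a k| ≤ 1 / k.factorial) (s : ℝ) :
    Summable fun k => a k * s ^ k := by
  refine Summable.of_norm_bounded (g := fun k => |s| ^ k / k.factorial)
    (Real.summable_pow_div_factorial |s|) fun k => ?_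
  rw [norm_mul, norm_pow, Real.norm_eq_abs, Real.norm_eq_abs, div_eq_mul_one_div, mul_comm]
  exact mul_le_mul_of_nonneg_left (ha k) (by positivity)

/-- The bound `1 / k!` is inherited by the coefficients of the derivative, so termwise
differentiation can be repeated. -/
theorem abs_derivCoeff_le {a : ℕ → ℝ} (ha : ∀ k, |a k| ≤ 1 / k.factorial) (k : ℕ) :
    |(k + 1) * a (k + 1)| ≤ 1 / k.factorial := by
  have h1 : (0 : ℝ) < k + 1 := by positivity
  rw [abs_mul, abs_of_pos h1]
  refine (mul_le_mul_of_nonneg_left (ha (k + 1)) h1.le).trans_eq ?_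
  rw [Nat.factorial_succ]
  push_cast
  field_simp

theorem hasDerivAt_tsum_mul_pow {a : ℕ → ℝ} (ha : ∀ k, |a k| ≤ 1 / k.factorial) (s : ℝ) :
    HasDerivAt (fun s => ∑' k, a k * s ^ k) (∑' k : ℕ, ((k + 1) * a (k + 1)) * s ^ k) s := by
  set R := |s| + 1
  have hR : s ∈ Metric.ball (0 : ℝ) R := by simp [R]
  -- This majorizes the differentiated series on the ball of radius `R`. The truncated exponent `k -
  -- 1` at `k = 0` is harmless because of the factor `k`.
  have hsum : Summable fun k : ℕ => (k : ℝ) * (1 / k.factorial) * R ^ (k - 1) := by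
    rw [← summable_nat_add_iff 1]
    refine (Real.summable_pow_div_factorial R).congr fun k => ?_
    rw [Nat.factorial_succ]
    push_cast
    field_simp
  have h := hasDerivAt_tsum_of_isPreconnected (g := fun k s => a k * s ^ k)
    (g' := fun k s => a k * (k * s ^ (k - 1))) (y₀ := s) (y := s) hsum Metric.isOpen_ball
    (convex_ball (0 : ℝ) R).isPreconnected
    (fun k y _ => (hasDerivAt_pow k y).const_mul (a k)) (fun k y hy => ?_) hR
    (summable_of_abs_le_inv_factorial ha s) hR
  · refine h.congr_deriv ?_
    have hs : Summable fun k : ℕ => a k * (k * s ^ (k - 1)) := by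
      rw [← summable_nat_add_iff 1]
      refine (summable_of_abs_le_inv_factorial (abs_derivCoeff_le ha) s).congr fun k => ?_
      push_cast
      ring_nf
    rw [hs.tsum_eq_zero_add]
    simp only [Nat.cast_zero, zero_mul, mul_zero, zero_add]
    refine tsum_congr fun k => ?_
    push_cast
    ring_nf
  · have hy' : |y| ≤ R := by
      have := mem_ball_zero_iff.1 hy
      exact this.le
    rw [norm_mul, norm_mul, norm_pow, Real.norm_eq_abs, Real.norm_eq_abs, Real.norm_eq_abs,
      Nat.abs_cast]
    calc |a k| * (k * |y| ^ (k - 1)) ≤ 1 / k.factorial * (k * R ^ (k - 1)) := by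
          gcongr
          exact ha k
      _ = k * (1 / k.factorial) * R ^ (k - 1) := by ring

/-- The coefficients of the power series `h` with `2 N h' + 4 s h'' = h` and `h 0 = 1`. -/
def radialCoeff (N : ℕ) : ℕ → ℝ
  | 0 => 1
  | k + 1 => radialCoeff N k / ((k + 1) * (2 * N + 4 * k))

variable {N : ℕ}

theorem radialCoeff_pos (hN : 0 < N) (k : ℕ) : 0 < radialCoeff N k := by
  have hN' : (0 : ℝ) < N := by exact_mod_cast hN
  induction k with
  | zero => simp [radialCoeff]
  | succ k ih => rw [radialCoeff]; positivity

theorem radialCoeff_succ_mul (hN : 0 < N) (k : ℕ) :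
    (k + 1) * (2 * N + 4 * k) * radialCoeff N (k + 1) = radialCoeff N k := by
  have hN' : (0 : ℝ) < N := by exact_mod_cast hN
  have : (0 : ℝ) < (k + 1) * (2 * N + 4 * k) := by positivity
  rw [radialCoeff, mul_div_cancel₀ _ this.ne']

theorem abs_radialCoeff_le (hN : 0 < N) (k : ℕ) : |radialCoeff N k| ≤ 1 / k.factorial := by
  have hN' : (1 : ℝ) ≤ N := by exact_mod_cast hN
  rw [abs_of_pos (radialCoeff_pos hN k)]
  induction k with
  | zero => simp [radialCoeff]
  | succ k ih =>
    rw [radialCoeff, Nat.factorial_succ]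
    push_cast
    have h0 : (0 : ℝ) < k + 1 := by positivity
    have h1 : (1 : ℝ) ≤ 2 * N + 4 * k := by
      have : (0 : ℝ) ≤ k := by positivity
      linarith
    calc radialCoeff N k / ((k + 1) * (2 * N + 4 * k))
        ≤ (1 / k.factorial) / ((k + 1) * 1) := by gcongr
      _ = 1 / ((k + 1) * k.factorial) := by field_simp

/-- For a function `h(‖x‖ ^ 2)` the equation `Δu = u` is this ODE, even at the origin. All
coefficients are positive, so `h s ≥ h 0 = 1` for `s ≥ 0`. -/
theorem exists_regular_solution (hN : 0 < N) : ∃ h h' h'' : ℝ → ℝ,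
    (∀ s, HasDerivAt h (h' s) s) ∧ (∀ s, HasDerivAt h' (h'' s) s) ∧ Continuous h'' ∧
    (∀ s, 2 * N * h' s + 4 * s * h'' s = h s) ∧ ∀ s, 0 ≤ s → 0 < h s := by
  have ha := abs_radialCoeff_le hN
  have ha' := abs_derivCoeff_le ha
  have ha'' := abs_derivCoeff_le ha'
  set c := radialCoeff N with hc
  refine ⟨fun s => ∑' k, c k * s ^ k, fun s => ∑' k : ℕ, ((k + 1) * c (k + 1)) * s ^ k,
    fun s => ∑' k : ℕ, ((k + 1) * (((k + 1 : ℕ) + 1) * c (k + 1 + 1))) * s ^ k,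
    hasDerivAt_tsum_mul_pow ha, hasDerivAt_tsum_mul_pow ha', ?_, ?_, ?_⟩
  · exact continuous_iff_continuousAt.2 fun s => (hasDerivAt_tsum_mul_pow ha'' s).continuousAt
  · intro s
    have hs0 : Summable fun k : ℕ => (k : ℝ) * ((k + 1) * c (k + 1)) * s ^ k := by
      rw [← summable_nat_add_iff 1]
      refine ((summable_of_abs_le_inv_factorial ha'' s).mul_left s).congr fun k => ?_
      push_cast
      ring
    -- The index shift puts all three series of the ODE on the same powers `s ^ k`, where the
    -- recurrence applies term by term.
    have h1 : s * ∑' k : ℕ, ((k + 1) * (((k + 1 : ℕ) + 1) * c (k + 1 + 1))) * s ^ k =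
        ∑' k : ℕ, (k : ℝ) * ((k + 1) * c (k + 1)) * s ^ k := by
      rw [hs0.tsum_eq_zero_add, ← tsum_mul_left]
      simp only [Nat.cast_zero, zero_mul, zero_add]
      refine tsum_congr fun k => ?_
      push_cast
      ring
    rw [mul_assoc 4, h1, ← tsum_mul_left, ← tsum_mul_left,
      ← ((summable_of_abs_le_inv_factorial ha' s).mul_left _).tsum_add (hs0.mul_left _)]
    refine tsum_congr fun k => ?_
    linear_combination s ^ k * radialCoeff_succ_mul hN k
  · intro s hs
    have h1 : c 0 * s ^ 0 ≤ ∑' k, c k * s ^ k :=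
      (summable_of_abs_le_inv_factorial ha s).le_tsum 0 fun k _ =>
        mul_nonneg (radialCoeff_pos hN k).le (pow_nonneg hs k)
    have h2 : c 0 * s ^ 0 = 1 := by simp [hc, radialCoeff]
    simp only
    linarith

end PowerSeries

/-! ### Radial profiles and their fluxes -/

/-- `f` solves `(r ^ (N - 1) f')' = r ^ (N - 1) k` on `(α, β)`, with flux `P = r ^ (N - 1) f'`
that extends continuously to `[α, β]`. -/
structure IsRadialSolution (N : ℕ) (α β : ℝ) (f f' k P : ℝ → ℝ) : Prop where
  continuousOn : ContinuousOn f (Set.Icc α β)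
  hasDerivAt : ∀ r ∈ Set.Ioo α β, HasDerivAt f (f' r) r
  continuousOn_flux : ContinuousOn P (Set.Icc α β)
  flux_eq : ∀ r ∈ Set.Ioo α β, P r = r ^ (N - 1) * f' r
  hasDerivAt_flux : ∀ r ∈ Set.Ioo α β, HasDerivAt P (r ^ (N - 1) * k r) r
  continuousOn_rhs : ContinuousOn k (Set.Icc α β)

section Profile

variable {N : ℕ} {α β : ℝ}

theorem hasDerivAt_flux_of_hasDerivAt {f' : ℝ → ℝ} {k r : ℝ} (hN : 0 < N) (hr : r ≠ 0)
    (h : HasDerivAt f' (k - (N - 1) / r * f' r) r) :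
    HasDerivAt (fun r => r ^ (N - 1) * f' r) (r ^ (N - 1) * k) r := by
  refine ((hasDerivAt_pow (N - 1) r).mul h).congr_deriv ?_
  -- The derivative of `r ^ (N - 1)` has the truncated exponent `N - 1 - 1`, so `N = 1` is treated
  -- apart; there its coefficient is zero.
  rcases N with _ | _ | n
  · omega
  · simp
  · simp only [Nat.add_sub_cancel, Nat.cast_add, Nat.cast_one, pow_succ]
    field_simp
    ring

theorem hasDerivAt_of_hasDerivAt_flux {f' : ℝ → ℝ} {k r : ℝ} (hN : 0 < N) (hr : 0 < r)
    (h : HasDerivAt (fun r => r ^ (N - 1) * f' r) (r ^ (N - 1) * k) r) :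
    HasDerivAt f' (k - (N - 1) / r * f' r) r := by
  have h1 := h.div (hasDerivAt_pow (N - 1) r) (pow_pos hr _).ne'
  have h2 : f' =ᶠ[𝓝 r] (fun r => r ^ (N - 1) * f' r) / fun r => r ^ (N - 1) := by
    filter_upwards [lt_mem_nhds hr] with s hs
    rw [Pi.div_apply, mul_div_cancel_left₀ _ (pow_pos hs _).ne']
  refine (h1.congr_of_eventuallyEq h2).congr_deriv ?_
  rcases N with _ | _ | n
  · omega
  · simp
  · simp only [Nat.add_sub_cancel, Nat.cast_add, Nat.cast_one, pow_succ]
    field_simp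
    ring

/-- Since `(P f)' = r ^ (N - 1) (f' ^ 2 + f ^ 2) ≥ 0` and `P f` vanishes at `α`, one has `f f' ≥ 0`.
Then `f ^ 2` does not decrease, so `f` never vanishes and stays positive, and `f' ≥ 0` follows. -/
theorem IsRadialSolution.monotone_of_flux_left_eq_zero {f f' P : ℝ → ℝ} (hα : 0 ≤ α) (hαβ : α < β)
    (h : IsRadialSolution N α β f f' f P) (hP : P α = 0) (hf : 0 < f α) :
    (∀ r ∈ Set.Icc α β, 0 < f r) ∧ MonotoneOn f (Set.Icc α β) := by
  have hint : interior (Set.Icc α β) = Set.Ioo α β := interior_Icc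
  have hr0 : ∀ r ∈ Set.Ioo α β, 0 < r := fun r hr => hα.trans_lt hr.1
  have hαm : α ∈ Set.Icc α β := ⟨le_rfl, hαβ.le⟩
  have hQ : MonotoneOn (P * f) (Set.Icc α β) := by
    refine monotoneOn_of_hasDerivWithinAt_nonneg (convex_Icc α β)
      (h.continuousOn_flux.mul h.continuousOn)
      (f' := fun r => r ^ (N - 1) * f r * f r + P r * f' r) (fun r hr => ?_) fun r hr => ?_
    · rw [hint] at hr
      exact ((h.hasDerivAt_flux r hr).mul (h.hasDerivAt r hr)).hasDerivWithinAt
    · rw [hint] at hr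
      have := hr0 r hr
      rw [h.flux_eq r hr, mul_assoc, mul_assoc, ← mul_add]
      exact mul_nonneg (by positivity) (add_nonneg (mul_self_nonneg _) (mul_self_nonneg _))
  have hQ0 : ∀ r ∈ Set.Icc α β, 0 ≤ P r * f r := fun r hr => by
    have := hQ hαm hr hr.1
    simpa [hP] using this
  have hsq : MonotoneOn (f * f) (Set.Icc α β) := by
    refine monotoneOn_of_hasDerivWithinAt_nonneg (convex_Icc α β)
      (h.continuousOn.mul h.continuousOn) (f' := fun r => f' r * f r + f r * f' r)
      (fun r hr => ?_) fun r hr => ?_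
    · rw [hint] at hr
      exact ((h.hasDerivAt r hr).mul (h.hasDerivAt r hr)).hasDerivWithinAt
    · rw [hint] at hr
      have h1 := hQ0 r ⟨hr.1.le, hr.2.le⟩
      rw [h.flux_eq r hr, mul_assoc] at h1
      have := nonneg_of_mul_nonneg_right h1 (pow_pos (hr0 r hr) (N - 1))
      linarith [mul_comm (f r) (f' r)]
  have hne : ∀ r ∈ Set.Icc α β, f r ≠ 0 := fun r hr h0 => by
    have := hsq hαm hr hr.1
    simp only [Pi.mul_apply, h0, mul_zero] at this
    nlinarith
  have hpos : ∀ r ∈ Set.Icc α β, 0 < f r := by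
    intro r hr
    by_contra! hle
    obtain ⟨s, hs, hs0⟩ := intermediate_value_Icc' hr.1
      (h.continuousOn.mono (Set.Icc_subset_Icc_right hr.2)) ⟨hle, hf.le⟩
    exact hne s ⟨hs.1, hs.2.trans hr.2⟩ hs0
  refine ⟨hpos, monotoneOn_of_hasDerivWithinAt_nonneg (convex_Icc α β) h.continuousOn (f' := f')
    (fun r hr => ?_) fun r hr => ?_⟩
  · rw [hint] at hr
    exact (h.hasDerivAt r hr).hasDerivWithinAt
  · rw [hint] at hr
    have h1 := hQ0 r ⟨hr.1.le, hr.2.le⟩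
    have h2 := nonneg_of_mul_nonneg_left h1 (hpos r ⟨hr.1.le, hr.2.le⟩)
    rw [h.flux_eq r hr] at h2
    exact nonneg_of_mul_nonneg_right h2 (pow_pos (hr0 r hr) (N - 1))

/-- Here `P f` still increases, but ends at `0`, so `f f' ≤ 0` and `f ^ 2` is bounded below by its
value at `β`. -/
theorem IsRadialSolution.antitone_of_flux_right_eq_zero {f f' P : ℝ → ℝ} (hα : 0 ≤ α) (hαβ : α < β)
    (h : IsRadialSolution N α β f f' f P) (hP : P β = 0) (hf : 0 < f β) :
    (∀ r ∈ Set.Icc α β, 0 < f r) ∧ AntitoneOn f (Set.Icc α β) := by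
  have hint : interior (Set.Icc α β) = Set.Ioo α β := interior_Icc
  have hr0 : ∀ r ∈ Set.Ioo α β, 0 < r := fun r hr => hα.trans_lt hr.1
  have hβm : β ∈ Set.Icc α β := ⟨hαβ.le, le_rfl⟩
  have hQ : MonotoneOn (P * f) (Set.Icc α β) := by
    refine monotoneOn_of_hasDerivWithinAt_nonneg (convex_Icc α β)
      (h.continuousOn_flux.mul h.continuousOn)
      (f' := fun r => r ^ (N - 1) * f r * f r + P r * f' r) (fun r hr => ?_) fun r hr => ?_
    · rw [hint] at hr
      exact ((h.hasDerivAt_flux r hr).mul (h.hasDerivAt r hr)).hasDerivWithinAt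
    · rw [hint] at hr
      have := hr0 r hr
      rw [h.flux_eq r hr, mul_assoc, mul_assoc, ← mul_add]
      exact mul_nonneg (by positivity) (add_nonneg (mul_self_nonneg _) (mul_self_nonneg _))
  have hQ0 : ∀ r ∈ Set.Icc α β, P r * f r ≤ 0 := fun r hr => by
    have := hQ hr hβm hr.2
    simpa [hP] using this
  have hsq : AntitoneOn (f * f) (Set.Icc α β) := by
    refine antitoneOn_of_hasDerivWithinAt_nonpos (convex_Icc α β)
      (h.continuousOn.mul h.continuousOn) (f' := fun r => f' r * f r + f r * f' r)
      (fun r hr => ?_) fun r hr => ?_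
    · rw [hint] at hr
      exact ((h.hasDerivAt r hr).mul (h.hasDerivAt r hr)).hasDerivWithinAt
    · rw [hint] at hr
      have h1 := hQ0 r ⟨hr.1.le, hr.2.le⟩
      rw [h.flux_eq r hr, mul_assoc] at h1
      have := nonpos_of_mul_nonpos_right h1 (pow_pos (hr0 r hr) (N - 1))
      linarith [mul_comm (f r) (f' r)]
  have hne : ∀ r ∈ Set.Icc α β, f r ≠ 0 := fun r hr h0 => by
    have := hsq hr hβm hr.2
    simp only [Pi.mul_apply, h0, mul_zero] at this
    nlinarith
  have hpos : ∀ r ∈ Set.Icc α β, 0 < f r := by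
    intro r hr
    by_contra! hle
    obtain ⟨s, hs, hs0⟩ := intermediate_value_Icc hr.2
      (h.continuousOn.mono (Set.Icc_subset_Icc_left hr.1)) ⟨hle, hf.le⟩
    exact hne s ⟨hr.1.trans hs.1, hs.2⟩ hs0
  refine ⟨hpos, antitoneOn_of_hasDerivWithinAt_nonpos (convex_Icc α β) h.continuousOn (f' := f')
    (fun r hr => ?_) fun r hr => ?_⟩
  · rw [hint] at hr
    exact (h.hasDerivAt r hr).hasDerivWithinAt
  · rw [hint] at hr
    have h1 := hQ0 r ⟨hr.1.le, hr.2.le⟩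
    have h2 := nonpos_of_mul_nonpos_left h1 (hpos r ⟨hr.1.le, hr.2.le⟩)
    rw [h.flux_eq r hr] at h2
    exact nonpos_of_mul_nonpos_right h2 (pow_pos (hr0 r hr) (N - 1))

theorem hasDerivAt_comp_sq {h : ℝ → ℝ} {d r : ℝ} (hh : HasDerivAt h d (r ^ 2)) :
    HasDerivAt (fun r => h (r ^ 2)) (2 * r * d) r := by
  refine (HasDerivAt.comp (h := fun r => r ^ 2) r hh (hasDerivAt_pow 2 r)).congr_deriv ?_
  simp only [Nat.cast_ofNat, Nat.add_one_sub_one, pow_one]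
  ring

theorem hasDerivAt_flux_comp_sq {h h' : ℝ → ℝ} {d r : ℝ} (hN : 0 < N) (hr : 0 < r)
    (hh' : HasDerivAt h' d (r ^ 2)) (hode : 2 * N * h' (r ^ 2) + 4 * r ^ 2 * d = h (r ^ 2)) :
    HasDerivAt (fun r => r ^ (N - 1) * (2 * r * h' (r ^ 2))) (r ^ (N - 1) * h (r ^ 2)) r := by
  refine hasDerivAt_flux_of_hasDerivAt (f' := fun r => 2 * r * h' (r ^ 2)) hN hr.ne' ?_
  have h1 : HasDerivAt (fun r : ℝ => 2 * r) 2 r := by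
    simpa using (hasDerivAt_id r).const_mul (2 : ℝ)
  refine (h1.mul (hasDerivAt_comp_sq hh')).congr_deriv ?_
  rw [← hode]
  field_simp
  ring

/-- The initial value problem `g'' + (N - 1) / r g' = g`, `g' r₀ = 0`, `g r₀ > 0` on `(0, ∞)`. -/
theorem exists_radial_solution_of_pos (hN : 0 < N) {r₀ : ℝ} (hr₀ : 0 < r₀) : ∃ g g' : ℝ → ℝ,
    (∀ r, 0 < r → HasDerivAt g (g' r) r) ∧
    (∀ r, 0 < r → HasDerivAt (fun r => r ^ (N - 1) * g' r) (r ^ (N - 1) * g r) r) ∧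
    0 < g r₀ ∧ g' r₀ = 0 := by
  obtain ⟨h, h', h'', hh, hh', -, hode, hpos⟩ := exists_regular_solution hN
  set A : ℝ → ℝ := fun r => h (r ^ 2) with hA
  set A' : ℝ → ℝ := fun r => 2 * r * h' (r ^ 2) with hA'
  have hApos : ∀ r, 0 < A r := fun r => hpos _ (sq_nonneg r)
  have dA : ∀ r, HasDerivAt A (A' r) r := fun r => hasDerivAt_comp_sq (hh (r ^ 2))
  have dA' : ∀ r, 0 < r → HasDerivAt (fun r => r ^ (N - 1) * A' r) (r ^ (N - 1) * A r) r :=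
    fun r hr => hasDerivAt_flux_comp_sq hN hr (hh' (r ^ 2)) (hode (r ^ 2))
  have hAc : Continuous A := continuous_iff_continuousAt.2 fun r => (dA r).continuousAt
  -- Reduction of order: for the positive solution `A`, the product `A ∫ q` is a second solution. It
  -- is available on `(0, ∞)` only, as `q` is singular at `0`.
  set q : ℝ → ℝ := fun s => (s ^ (N - 1) * A s ^ 2)⁻¹ with hq
  have hqc : ContinuousOn q (Set.Ioi 0) := by
    refine ContinuousOn.inv₀ (by fun_prop) fun s hs => ?_
    have h1 := hApos s
    have h2 : (0 : ℝ) < s := hs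
    positivity
  set J : ℝ → ℝ := fun r => ∫ s in r₀..r, q s with hJ
  have dJ : ∀ r, 0 < r → HasDerivAt J (q r) r := by
    intro r hr
    have hsub : Set.uIcc r₀ r ⊆ Set.Ioi 0 := fun s hs =>
      (lt_min hr₀ hr).trans_le hs.1
    refine intervalIntegral.integral_hasDerivAt_right (hqc.mono hsub).intervalIntegrable ?_
      (hqc.continuousAt (Ioi_mem_nhds hr))
    exact hqc.stronglyMeasurableAtFilter isOpen_Ioi r hr
  -- This `c` solves `A' r₀ + c A r₀ q r₀ = 0`, the condition that the derivative of `A (1 + c J)`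
  -- vanish at `r₀`.
  set c : ℝ := -(r₀ ^ (N - 1) * A' r₀ * A r₀) with hc
  have hJ0 : J r₀ = 0 := intervalIntegral.integral_same
  refine ⟨fun r => A r * (1 + c * J r), fun r => A' r * (1 + c * J r) + A r * (c * q r), ?_, ?_,
    ?_, ?_⟩
  · intro r hr
    exact (dA r).mul (((dJ r hr).const_mul c).const_add 1)
  · intro r hr
    have h1 : (fun r => r ^ (N - 1) * (A' r * (1 + c * J r) + A r * (c * q r))) =ᶠ[𝓝 r]
        fun r => r ^ (N - 1) * A' r * (1 + c * J r) + c * (A r)⁻¹ := by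
      filter_upwards [lt_mem_nhds hr] with s hs
      have := hApos s
      simp only [hq]
      field_simp
    refine HasDerivAt.congr_of_eventuallyEq ?_ h1
    refine (((dA' r hr).mul (((dJ r hr).const_mul c).const_add 1)).add
      (((dA r).inv (hApos r).ne').const_mul c)).congr_deriv ?_
    have := hApos r
    simp only [hq]
    field_simp
    ring
  · simpa [hJ0] using hApos r₀
  · have := hApos r₀
    simp only [hJ0, hq, hc]
    field_simp
    ring

end Profile

/-! ### Existence for the limit problems -/

section Existence

variable {N : ℕ} {α β : ℝ}

theorem norm_add_smul_normal {x : EuclideanSpace ℝ (Fin N)} (hx : 0 < ‖x‖) {t : ℝ}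
    (ht : 0 ≤ ‖x‖ + t) : ‖x + t • (‖x‖⁻¹ • x)‖ = ‖x‖ + t := by
  have h : x + t • (‖x‖⁻¹ • x) = ((‖x‖ + t) / ‖x‖) • x := by
    rw [smul_smul, add_div, div_self hx.ne', add_smul, one_smul, div_eq_mul_inv]
  rw [h, norm_smul, Real.norm_eq_abs, abs_div, abs_of_pos hx, div_mul_cancel₀ _ hx.ne',
    abs_of_nonneg ht]

theorem normalDerivEqZero_comp_norm {g : ℝ → ℝ} {x : EuclideanSpace ℝ (Fin N)} (hx : 0 < ‖x‖)
    (hg : HasDerivAt g 0 ‖x‖) : NormalDerivEqZero N α β (fun y => g ‖y‖) x := by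
  have h1 : HasDerivAt (fun t => g (‖x‖ + t)) 0 0 :=
    HasDerivAt.comp_const_add ‖x‖ 0 (by simpa using hg)
  have h2 : (fun t : ℝ => g ‖x + t • (‖x‖⁻¹ • x)‖) =ᶠ[𝓝 0] fun t => g (‖x‖ + t) := by
    filter_upwards [lt_mem_nhds (neg_lt_zero.2 hx)] with t ht
    rw [norm_add_smul_normal hx (by linarith)]
  exact (h1.congr_of_eventuallyEq h2).hasDerivWithinAt

theorem solvesEquation_comp_norm {g g' : ℝ → ℝ} (hN : 0 < N) (hα : 0 < α)
    (hg : ∀ r, 0 < r → HasDerivAt g (g' r) r)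
    (hg' : ∀ r, 0 < r → HasDerivAt (fun r => r ^ (N - 1) * g' r) (r ^ (N - 1) * g r) r) :
    SolvesEquation N α β (fun _ => 0) fun x => g ‖x‖ := by
  have hg'' : ∀ r, 0 < r → HasDerivAt g' (g r - (N - 1) / r * g' r) r := fun r hr =>
    hasDerivAt_of_hasDerivAt_flux hN hr (hg' r hr)
  have hgc : ContinuousOn g (Set.Ioi 0) := fun r hr => (hg r hr).continuousAt.continuousWithinAt
  have hgc' : ContinuousOn g' (Set.Ioi 0) := fun r hr =>
    (hg'' r hr).continuousAt.continuousWithinAt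
  have hC1 : ContDiffOn ℝ 1 g' (Set.Ioi 0) := by
    refine (contDiffOn_one_iff_derivWithin isOpen_Ioi.uniqueDiffOn).2
      ⟨fun r hr => (hg'' r hr).differentiableAt.differentiableWithinAt, ?_⟩
    have : ContinuousOn (fun r => g r - (N - 1) / r * g' r) (Set.Ioi 0) := by
      refine hgc.sub ((continuousOn_const.div continuousOn_id fun r hr => ?_).mul hgc')
      exact ne_of_gt hr
    refine this.congr fun r hr => ?_
    exact (hg'' r hr).hasDerivWithinAt.derivWithin (isOpen_Ioi.uniqueDiffOn r hr)
  have hC2 : ContDiffOn ℝ 2 g (Set.Ioi 0) := by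
    have h2 : (2 : WithTop ℕ∞) = 1 + 1 := by norm_num
    rw [h2, contDiffOn_succ_iff_deriv_of_isOpen isOpen_Ioi]
    refine ⟨fun r hr => (hg r hr).differentiableAt.differentiableWithinAt, by simp, ?_⟩
    exact hC1.congr fun r hr => (hg r hr).deriv
  refine ⟨?_, ?_, ?_⟩
  · intro x hx
    have hx0 : 0 < ‖x‖ := hα.trans (hx.2 hα)
    exact ((hC2.contDiffAt (Ioi_mem_nhds hx0)).comp x
      (contDiffAt_norm ℝ (norm_pos_iff.1 hx0))).contDiffWithinAt
  · intro x hx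
    have hx0 : 0 < ‖x‖ := hα.trans_le hx.1
    exact ((hg _ hx0).continuousAt.comp continuous_norm.continuousAt).continuousWithinAt
  · intro x hx
    have hx0 : 0 < ‖x‖ := hα.trans (hx.2 hα)
    rw [laplacian_comp_norm (norm_pos_iff.1 hx0)
      ((lt_mem_nhds hx0).mono fun r hr => hg r hr) (hg'' _ hx0)]
    ring

theorem isRadialSolution_of_pos {g g' : ℝ → ℝ} (hα : 0 < α)
    (hg : ∀ r, 0 < r → HasDerivAt g (g' r) r)
    (hg' : ∀ r, 0 < r → HasDerivAt (fun r => r ^ (N - 1) * g' r) (r ^ (N - 1) * g r) r) :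
    IsRadialSolution N α β g g' g fun r => r ^ (N - 1) * g' r where
  continuousOn r hr := (hg r (hα.trans_le hr.1)).continuousAt.continuousWithinAt
  hasDerivAt r hr := hg r (hα.trans hr.1)
  continuousOn_flux r hr := (hg' r (hα.trans_le hr.1)).continuousAt.continuousWithinAt
  flux_eq _ _ := rfl
  hasDerivAt_flux r hr := hg' r (hα.trans hr.1)
  continuousOn_rhs r hr := (hg r (hα.trans_le hr.1)).continuousAt.continuousWithinAt

theorem IsRadialSolution.const_mul {f f' k P : ℝ → ℝ} (h : IsRadialSolution N α β f f' k P)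
    (c : ℝ) : IsRadialSolution N α β (fun r => c * f r) (fun r => c * f' r) (fun r => c * k r)
      fun r => c * P r where
  continuousOn := h.continuousOn.const_mul c
  hasDerivAt r hr := (h.hasDerivAt r hr).const_mul c
  continuousOn_flux := h.continuousOn_flux.const_mul c
  flux_eq r hr := by rw [h.flux_eq r hr]; ring
  hasDerivAt_flux r hr := ((h.hasDerivAt_flux r hr).const_mul c).congr_deriv (by ring)
  continuousOn_rhs := h.continuousOn_rhs.const_mul c

theorem SolvesEquation.const_mul {u : EuclideanSpace ℝ (Fin N) → ℝ}
    (hu : SolvesEquation N α β (fun _ => 0) u) (c : ℝ) :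
    SolvesEquation N α β (fun _ => 0) fun x => c * u x := by
  refine ⟨contDiffOn_const.mul hu.contDiffOn, hu.continuousOn.const_mul c, fun x hx => ?_⟩
  have h1 : (Δ fun x => c * u x) x = c • (Δ u) x :=
    InnerProductSpace.laplacian_smul c (hu.contDiffOn.contDiffAt (isOpen_annulus.mem_nhds hx))
  rw [h1, smul_eq_mul]
  linear_combination c * hu.equation x hx

/-- The radial solution of the Neumann-Dirichlet problem that is singled out by a vanishing flux
at the inner end. -/
theorem exists_radial_solvesEquation_left (hN : 2 ≤ N) (hα : 0 ≤ α) : ∃ g g' P : ℝ → ℝ,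
    SolvesEquation N α β (fun _ => 0) (fun x => g ‖x‖) ∧ IsRadialSolution N α β g g' g P ∧
    P α = 0 ∧ 0 < g α ∧
    (0 < α → ∀ x : EuclideanSpace ℝ (Fin N), ‖x‖ = α →
      NormalDerivEqZero N α β (fun x => g ‖x‖) x) := by
  have hN0 : 0 < N := by omega
  -- On the ball the power series solution itself is taken, and its flux vanishes at `0`. On an
  -- annulus the initial value problem is solved from `r₀ = α`.
  rcases hα.eq_or_lt with rfl | hα
  · obtain ⟨h, h', h'', hh, hh', hc, hode, hpos⟩ := exists_regular_solution hN0
    have hhc : Continuous h := continuous_iff_continuousAt.2 fun s => (hh s).continuousAt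
    have hhc' : Continuous h' := continuous_iff_continuousAt.2 fun s => (hh' s).continuousAt
    have hC1 : ContDiff ℝ 1 h' := by
      rw [contDiff_one_iff_deriv]
      refine ⟨fun s => (hh' s).differentiableAt, ?_⟩
      rwa [show deriv h' = h'' from funext fun s => (hh' s).deriv]
    have hC2 : ContDiff ℝ 2 h := by
      have h2 : (2 : WithTop ℕ∞) = 1 + 1 := by norm_num
      rw [h2, contDiff_succ_iff_deriv]
      refine ⟨fun s => (hh s).differentiableAt, by simp, ?_⟩
      rwa [show deriv h = h' from funext fun s => (hh s).deriv]
    refine ⟨fun r => h (r ^ 2), fun r => 2 * r * h' (r ^ 2),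
      fun r => r ^ (N - 1) * (2 * r * h' (r ^ 2)),
      ⟨?_, ?_, ?_⟩, ⟨?_, ?_, ?_, ?_, ?_, ?_⟩, ?_, ?_, ?_⟩
    · exact (hC2.comp (contDiff_norm_sq ℝ)).contDiffOn
    · exact (hhc.comp (continuous_norm.pow 2)).continuousOn
    · intro x _
      rw [laplacian_comp_norm_sq (Eventually.of_forall hh) (hh' _), hode]
      ring
    · exact Continuous.continuousOn (by fun_prop)
    · exact fun r _ => hasDerivAt_comp_sq (hh _)
    · exact Continuous.continuousOn (by fun_prop)
    · exact fun r _ => rfl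
    · exact fun r hr => hasDerivAt_flux_comp_sq hN0 hr.1 (hh' _) (hode _)
    · exact Continuous.continuousOn (by fun_prop)
    · simp
    · exact hpos _ (sq_nonneg _)
    · exact fun h => absurd h (lt_irrefl _)
  · obtain ⟨g, g', hg, hg', hpos, h0⟩ := exists_radial_solution_of_pos hN0 hα
    refine ⟨g, g', _, solvesEquation_comp_norm hN0 hα hg hg', isRadialSolution_of_pos hα hg hg',
      by simp [h0], hpos, fun _ x hx => ?_⟩
    refine normalDerivEqZero_comp_norm (hx ▸ hα) ?_
    have := hg α hα
    rwa [h0, ← hx] at this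

theorem exists_solvesLimitPlus (hN : 2 ≤ N) (hα : 0 ≤ α) (hαβ : α < β) :
    ∃ g g' P : ℝ → ℝ, SolvesLimitPlus N α β (fun x => g ‖x‖) ∧ IsRadialSolution N α β g g' g P ∧
    P α = 0 ∧ g β = 1 ∧ (∀ r ∈ Set.Icc α β, 0 < g r) ∧ MonotoneOn g (Set.Icc α β) := by
  obtain ⟨g, g', P, hsol, hrad, hP, h0, hneu⟩ :=
    exists_radial_solvesEquation_left (β := β) hN hα
  have hpos := (hrad.monotone_of_flux_left_eq_zero hα hαβ hP h0).1 β ⟨hαβ.le, le_rfl⟩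
  have hrad' := hrad.const_mul (g β)⁻¹
  have hP' : (g β)⁻¹ * P α = 0 := by rw [hP, mul_zero]
  obtain ⟨h1, h2⟩ := hrad'.monotone_of_flux_left_eq_zero hα hαβ hP' (by positivity)
  refine ⟨_, _, _, ⟨hsol.const_mul _, fun hα x hx => ?_, fun x hx => ?_⟩, hrad', hP', ?_, h1, h2⟩
  · have := HasDerivWithinAt.const_mul (g β)⁻¹ (hneu hα x hx)
    rw [mul_zero] at this
    exact this
  · rw [hx]
    exact inv_mul_cancel₀ hpos.ne'
  · exact inv_mul_cancel₀ hpos.ne'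

theorem exists_solvesLimitMinus (hN : 2 ≤ N) (hα : 0 < α) (hαβ : α < β) :
    ∃ g g' P : ℝ → ℝ, SolvesLimitMinus N α β (fun x => g ‖x‖) ∧ IsRadialSolution N α β g g' g P ∧
    P β = 0 ∧ g α = 1 ∧ (∀ r ∈ Set.Icc α β, 0 < g r) ∧ AntitoneOn g (Set.Icc α β) := by
  have hN0 : 0 < N := by omega
  have hβ : 0 < β := hα.trans hαβ
  obtain ⟨g, g', hg, hg', h0, hd⟩ := exists_radial_solution_of_pos hN0 hβ
  have hsol := solvesEquation_comp_norm (β := β) hN0 hα hg hg'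
  have hrad := isRadialSolution_of_pos (β := β) hα hg hg'
  have hpos := (hrad.antitone_of_flux_right_eq_zero hα.le hαβ (by simp [hd]) h0).1 α
    ⟨le_rfl, hαβ.le⟩
  have hrad' := hrad.const_mul (g α)⁻¹
  have hP' : (g α)⁻¹ * (β ^ (N - 1) * g' β) = 0 := by simp [hd]
  obtain ⟨h1, h2⟩ := hrad'.antitone_of_flux_right_eq_zero hα.le hαβ hP' (by positivity)
  refine ⟨_, _, _, ⟨hsol.const_mul _, fun x hx => ?_, fun x hx => ?_⟩, hrad', hP', ?_, h1, h2⟩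
  · refine normalDerivEqZero_comp_norm (g := fun r => (g α)⁻¹ * g r) (hx ▸ hβ) ?_
    have := (hg β hβ).const_mul (g α)⁻¹
    rwa [hd, mul_zero, ← hx] at this
  · rw [hx]
    exact inv_mul_cancel₀ hpos.ne'
  · exact inv_mul_cancel₀ hpos.ne'

end Existence

/-! ### The profile of a radial solution of the Neumann problem -/

section NeumannProfile

variable {N : ℕ} {α β p : ℝ}

theorem hasDerivWithinAt_profile_of_normalDerivEqZero {u : EuclideanSpace ℝ (Fin N) → ℝ}
    {e : EuclideanSpace ℝ (Fin N)} (he : ‖e‖ = 1) {b : ℝ} (hα : 0 ≤ α) (hb : 0 < b)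
    (hu : NormalDerivEqZero N α β u (b • e)) :
    HasDerivWithinAt (fun r : ℝ => u (r • e)) 0 (Set.Icc α β) b := by
  have hnorm : ‖b • e‖ = b := by rw [norm_smul, he, mul_one, Real.norm_of_nonneg hb.le]
  have hν : ‖b • e‖⁻¹ • b • e = e := by rw [hnorm, smul_smul, inv_mul_cancel₀ hb.ne', one_smul]
  rw [NormalDerivEqZero, hν] at hu
  have h1 : HasDerivWithinAt (fun t : ℝ => u (b • e + t • e)) 0
      ((fun t : ℝ => b • e + t • e) ⁻¹' closedAnnulus N α β) (b - b) := by
    rw [sub_self]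
    exact hu
  have h2 : HasDerivWithinAt (fun r : ℝ => r - b) 1 (Set.Icc α β) b :=
    ((hasDerivAt_id b).sub_const b).hasDerivWithinAt
  have h3 : ∀ r : ℝ, b • e + (r - b) • e = r • e := fun r => by rw [← add_smul]; congr 1; ring
  have h4 : Set.MapsTo (fun r : ℝ => r - b) (Set.Icc α β)
      ((fun t : ℝ => b • e + t • e) ⁻¹' closedAnnulus N α β) := fun r hr => by
    have hr0 : ‖r • e‖ = r := by
      rw [norm_smul, he, mul_one, Real.norm_of_nonneg (hα.trans hr.1)]
    change α ≤ ‖b • e + (r - b) • e‖ ∧ ‖b • e + (r - b) • e‖ ≤ β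
    rwa [h3, hr0]
  have h5 := HasDerivWithinAt.comp (h := fun r => r - b) b h1 h2 h4
  simp only [Function.comp_def, h3, zero_mul] at h5
  exact h5

/-- The profile is the restriction of `u` to a ray. Nothing is assumed about `f'` up to the
boundary: the equation makes the flux Lipschitz on `(α, β)`, hence extendable, and the Neumann
conditions say that the extension vanishes at the ends. -/
theorem exists_profile_of_solvesNeumann (hN : 2 ≤ N) (hα : 0 ≤ α) (hαβ : α < β) (hp : 0 < p)
    {u : EuclideanSpace ℝ (Fin N) → ℝ} (hrad : MemH1Rad N α β u) (hu : SolvesNeumann N α β p u) :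
    ∃ f f' P : ℝ → ℝ, (∀ x ∈ closedAnnulus N α β, u x = f ‖x‖) ∧
      IsRadialSolution N α β f f' (fun r => f r - f r ^ p) P ∧ P α = 0 ∧ P β = 0 := by
  have hN0 : 0 < N := by omega
  have hβ : 0 < β := hα.trans_lt hαβ
  set e : EuclideanSpace ℝ (Fin N) := EuclideanSpace.single ⟨0, hN0⟩ 1 with he'
  have he : ‖e‖ = 1 := by simp [he']
  have hnorm : ∀ r : ℝ, 0 ≤ r → ‖r • e‖ = r := fun r hr => by
    rw [norm_smul, he, mul_one, Real.norm_of_nonneg hr]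
  set f : ℝ → ℝ := fun r => u (r • e) with hf
  set f' : ℝ → ℝ := fun r => fderiv ℝ u (r • e) e with hf'
  have hr0 : ∀ r ∈ Set.Ioo α β, 0 < r := fun r hr => hα.trans_lt hr.1
  have hmemc : ∀ r ∈ Set.Icc α β, r • e ∈ closedAnnulus N α β := fun r hr => by
    change α ≤ ‖r • e‖ ∧ ‖r • e‖ ≤ β
    rw [hnorm r (hα.trans hr.1)]
    exact hr
  have hmem : ∀ r ∈ Set.Ioo α β, r • e ∈ annulus N α β := fun r hr =>
    mem_annulus_of_norm_mem_Ioo (by rwa [hnorm r (hr0 r hr).le])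
  have hlink : ∀ x ∈ closedAnnulus N α β, u x = f ‖x‖ := fun x hx =>
    hrad.radial x hx _ (hmemc _ hx) (hnorm _ (norm_nonneg x)).symm
  have hline : ∀ r : ℝ, HasDerivAt (fun r : ℝ => r • e) e r := fun r => by
    simpa using (hasDerivAt_id r).smul_const e
  have hfc : ContinuousOn f (Set.Icc α β) :=
    hu.solves.continuousOn.comp (by fun_prop) hmemc
  have hC2 : ∀ r ∈ Set.Ioo α β, ContDiffAt ℝ 2 u (r • e) := fun r hr =>
    hu.solves.contDiffOn.contDiffAt (isOpen_annulus.mem_nhds (hmem r hr))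
  have hd : ∀ r ∈ Set.Ioo α β, HasDerivAt f (f' r) r := fun r hr =>
    ((hC2 r hr).differentiableAt (by simp)).hasFDerivAt.comp_hasDerivAt r (hline r)
  have hd' : ∀ r ∈ Set.Ioo α β, HasDerivAt f' (f r - f r ^ p - (N - 1) / r * f' r) r := by
    intro r hr
    have h1 : DifferentiableAt ℝ (fderiv ℝ u) (r • e) :=
      ((hC2 r hr).fderiv_right (m := 1) (by norm_num)).differentiableAt (by simp)
    have h1' : HasDerivAt (fun r : ℝ => fderiv ℝ u (r • e)) (fderiv ℝ (fderiv ℝ u) (r • e) e) r :=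
      HasFDerivAt.comp_hasDerivAt (l := fderiv ℝ u) r h1.hasFDerivAt (hline r)
    have h2 : HasDerivAt f' (fderiv ℝ (fderiv ℝ u) (r • e) e e) r :=
      (h1'.clm_apply (hasDerivAt_const r e)).congr_deriv (by simp)
    refine h2.congr_deriv ?_
    have hnr := hnorm r (hr0 r hr).le
    have h3 : u =ᶠ[𝓝 (r • e)] fun y => f ‖y‖ := by
      filter_upwards [isOpen_annulus.mem_nhds (hmem r hr)] with y hy
      exact hlink y (annulus_subset_closedAnnulus hα hy)
    have h4 : (Δ u) (r • e) = _ := (InnerProductSpace.laplacian_congr_nhds h3).self_of_nhds.trans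
      (laplacian_comp_norm (f' := f') (f'' := fderiv ℝ (fderiv ℝ u) (r • e) e e)
        (norm_pos_iff.1 (by rw [hnr]; exact hr0 r hr))
        (by rw [hnr]; exact mem_of_superset (isOpen_Ioo.mem_nhds hr) hd)
        (by rwa [hnr]))
    rw [hnr] at h4
    have h5 := hu.solves.equation _ (hmem r hr)
    rw [h4] at h5
    simp only [hf]
    linarith
  have hfl : ∀ r ∈ Set.Ioo α β, HasDerivAt (fun r => r ^ (N - 1) * f' r)
      (r ^ (N - 1) * (f r - f r ^ p)) r := fun r hr =>
    hasDerivAt_flux_of_hasDerivAt hN0 (hr0 r hr).ne' (hd' r hr)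
  have hkc : ContinuousOn (fun r => f r - f r ^ p) (Set.Icc α β) :=
    hfc.sub (hfc.rpow_const fun _ _ => Or.inr hp.le)
  obtain ⟨K, hK⟩ := isCompact_Icc.exists_bound_of_continuousOn hkc
  have hK0 : 0 ≤ K := (norm_nonneg _).trans (hK α ⟨le_rfl, hαβ.le⟩)
  have hlip : LipschitzOnWith (Real.toNNReal (β ^ (N - 1) * K)) (fun r => r ^ (N - 1) * f' r)
      (Set.Ioo α β) := by
    refine Convex.lipschitzOnWith_of_nnnorm_hasDerivWithin_le (convex_Ioo α β)
      (fun r hr => (hfl r hr).hasDerivWithinAt) fun r hr => ?_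
    rw [← NNReal.coe_le_coe, coe_nnnorm, Real.coe_toNNReal _ (by positivity), norm_mul, norm_pow,
      Real.norm_of_nonneg (hr0 r hr).le]
    have := (hr0 r hr).le
    have h1 := hr.2.le
    have h2 := hK r ⟨hr.1.le, hr.2.le⟩
    gcongr
  obtain ⟨P, hPl, hPe⟩ := hlip.extend_real
  have hPc : Continuous P := hPl.continuous
  have hderiv : ∀ r ∈ Set.Ioo α β, deriv f r = P r / r ^ (N - 1) := fun r hr => by
    rw [(hd r hr).deriv, ← hPe hr, mul_div_cancel_left₀ _ (pow_pos (hr0 r hr) _).ne']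
  have hdiff : DifferentiableOn ℝ f (Set.Ioo α β) := fun r hr =>
    (hd r hr).differentiableAt.differentiableWithinAt
  have huniq : UniqueDiffOn ℝ (Set.Icc α β) := uniqueDiffOn_Icc hαβ
  have hlim : ∀ b : ℝ, 0 < b → ContinuousAt (fun r => P r / r ^ (N - 1)) b := fun b hb =>
    hPc.continuousAt.div (continuous_pow _).continuousAt (pow_pos hb _).ne'
  refine ⟨f, f', P, hlink, ⟨hfc, hd, hPc.continuousOn, fun r hr => (hPe hr).symm, fun r hr => ?_,
    hkc⟩, ?_, ?_⟩
  · refine (hfl r hr).congr_of_eventuallyEq ?_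
    filter_upwards [isOpen_Ioo.mem_nhds hr] with s hs using (hPe hs).symm
  -- At the origin `f'` is continuous, since `u` is `C²` there, and the factor `r ^ (N - 1)` tends
  -- to zero because `N ≥ 2`.
  · rcases hα.eq_or_lt with rfl | hα'
    · have h1 : Tendsto P (𝓝[>] 0) (𝓝 (P 0)) := hPc.continuousAt.continuousWithinAt
      have h2 : ContinuousAt f' 0 := by
        have h0 : (0 : EuclideanSpace ℝ (Fin N)) ∈ annulus N 0 β := ⟨by simpa using hβ, by simp⟩
        have h3 : ContinuousAt (fderiv ℝ u) ((0 : ℝ) • e) := by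
          rw [zero_smul]
          exact ((hu.solves.contDiffOn.contDiffAt (isOpen_annulus.mem_nhds h0)).fderiv_right
            (m := 1) (by norm_num)).continuousAt
        have h4 : ContinuousAt (fun r : ℝ => fderiv ℝ u (r • e)) 0 :=
          ContinuousAt.comp (g := fderiv ℝ u) h3 (hline 0).continuousAt
        exact h4.clm_apply continuousAt_const
      have h3 : Tendsto P (𝓝[>] 0) (𝓝 (0 ^ (N - 1) * f' 0)) := by
        have h5 : ContinuousAt (fun r => r ^ (N - 1) * f' r) 0 :=
          (continuous_pow _).continuousAt.mul h2
        refine Tendsto.congr' ?_ h5.continuousWithinAt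
        filter_upwards [Ioo_mem_nhdsGT hβ] with s hs using hPe hs
      rw [tendsto_nhds_unique h1 h3, zero_pow (by omega), zero_mul]
    -- The one-sided derivative at `α` is computed twice: as the limit of `f'`, which is `P α / α ^
    -- (N - 1)`, and as `0` by the Neumann condition.
    · have h1 : HasDerivWithinAt f (P α / α ^ (N - 1)) (Set.Ici α) α := by
        refine hasDerivWithinAt_Ici_of_tendsto_deriv hdiff
          ((hfc α ⟨le_rfl, hαβ.le⟩).mono Set.Ioo_subset_Icc_self) (Ioo_mem_nhdsGT hαβ) ?_
        refine Tendsto.congr' ?_ (hlim α hα').continuousWithinAt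
        filter_upwards [Ioo_mem_nhdsGT hαβ] with s hs using (hderiv s hs).symm
      have h2 := hasDerivWithinAt_profile_of_normalDerivEqZero he hα hα'
        (hu.neumann_inner hα' _ (hnorm α hα))
      have h3 := (huniq α ⟨le_rfl, hαβ.le⟩).eq_deriv _ (h1.mono Set.Icc_subset_Ici_self) h2
      exact (div_eq_zero_iff.1 h3).resolve_right (pow_pos hα' _).ne'
  · have h1 : HasDerivWithinAt f (P β / β ^ (N - 1)) (Set.Iic β) β := by
      refine hasDerivWithinAt_Iic_of_tendsto_deriv hdiff
        ((hfc β ⟨hαβ.le, le_rfl⟩).mono Set.Ioo_subset_Icc_self) (Ioo_mem_nhdsLT hαβ) ?_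
      refine Tendsto.congr' ?_ (hlim β hβ).continuousWithinAt
      filter_upwards [Ioo_mem_nhdsLT hαβ] with s hs using (hderiv s hs).symm
    have h2 := hasDerivWithinAt_profile_of_normalDerivEqZero he hα hβ
      (hu.neumann_outer _ (hnorm β hβ.le))
    have h3 := (huniq β ⟨hαβ.le, le_rfl⟩).eq_deriv _ (h1.mono Set.Icc_subset_Iic_self) h2
    exact (div_eq_zero_iff.1 h3).resolve_right (pow_pos hβ _).ne'

end NeumannProfile

/-! ### Profiles, their energies and the Green formula -/

/-- The bilinear form of `H¹` in polar coordinates, up to the area of the sphere. -/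
def radialForm (N : ℕ) (α β : ℝ) (f f' g g' : ℝ → ℝ) : ℝ :=
  ∫ r in α..β, r ^ (N - 1) * (f' r * g' r + f r * g r)

/-- `f` is continuous on `[α, β]` and has the bounded continuous derivative `f'` on `(α, β)`. -/
structure IsProfile (α β : ℝ) (f f' : ℝ → ℝ) : Prop where
  continuousOn : ContinuousOn f (Set.Icc α β)
  hasDerivAt : ∀ r ∈ Set.Ioo α β, HasDerivAt f (f' r) r
  continuousOn_deriv : ContinuousOn f' (Set.Ioo α β)
  bounded_deriv : ∃ L, ∀ r ∈ Set.Ioo α β, |f' r| ≤ L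

section ProfileCalculus

variable {N : ℕ} {α β : ℝ} {f f' g g' k P : ℝ → ℝ}

theorem intervalIntegrable_of_continuousOn_Ioo {F : ℝ → ℝ} {C : ℝ} (hαβ : α ≤ β)
    (hF : ContinuousOn F (Set.Ioo α β)) (hC : ∀ r ∈ Set.Ioo α β, |F r| ≤ C) :
    IntervalIntegrable F volume α β := by
  rw [intervalIntegrable_iff_integrableOn_Ioo_of_le hαβ]
  refine IntegrableOn.of_bound (by simp) (hF.aestronglyMeasurable measurableSet_Ioo) C ?_
  exact (ae_restrict_iff' measurableSet_Ioo).2 (Eventually.of_forall hC)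

theorem IsProfile.exists_bound (hαβ : α ≤ β) (hf : IsProfile α β f f') :
    ∃ C, 0 ≤ C ∧ (∀ r ∈ Set.Icc α β, |f r| ≤ C) ∧ ∀ r ∈ Set.Ioo α β, |f' r| ≤ C := by
  obtain ⟨A, hA⟩ := isCompact_Icc.exists_bound_of_continuousOn hf.continuousOn
  obtain ⟨B, hB⟩ := hf.bounded_deriv
  have hA0 : 0 ≤ A := (norm_nonneg _).trans (hA α ⟨le_rfl, hαβ⟩)
  exact ⟨max A B, hA0.trans (le_max_left _ _), fun r hr => (hA r hr).trans (le_max_left _ _),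
    fun r hr => (hB r hr).trans (le_max_right _ _)⟩

theorem IsProfile.const_mul (hf : IsProfile α β f f') (c : ℝ) :
    IsProfile α β (fun r => c * f r) fun r => c * f' r where
  continuousOn := hf.continuousOn.const_mul c
  hasDerivAt r hr := (hf.hasDerivAt r hr).const_mul c
  continuousOn_deriv := hf.continuousOn_deriv.const_mul c
  bounded_deriv := by
    obtain ⟨L, hL⟩ := hf.bounded_deriv
    refine ⟨|c| * L, fun r hr => ?_⟩
    rw [abs_mul]
    exact mul_le_mul_of_nonneg_left (hL r hr) (abs_nonneg c)

theorem IsProfile.sub (hf : IsProfile α β f f') (hg : IsProfile α β g g') :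
    IsProfile α β (fun r => f r - g r) fun r => f' r - g' r where
  continuousOn := hf.continuousOn.sub hg.continuousOn
  hasDerivAt r hr := (hf.hasDerivAt r hr).sub (hg.hasDerivAt r hr)
  continuousOn_deriv := hf.continuousOn_deriv.sub hg.continuousOn_deriv
  bounded_deriv := by
    obtain ⟨L, hL⟩ := hf.bounded_deriv
    obtain ⟨L', hL'⟩ := hg.bounded_deriv
    exact ⟨L + L', fun r hr => (abs_sub _ _).trans (add_le_add (hL r hr) (hL' r hr))⟩

theorem intervalIntegrable_weight_mul (hα : 0 ≤ α) (hαβ : α ≤ β) {F : ℝ → ℝ} {C : ℝ}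
    (hF : ContinuousOn F (Set.Ioo α β)) (hC : ∀ r ∈ Set.Ioo α β, |F r| ≤ C) :
    IntervalIntegrable (fun r => r ^ (N - 1) * F r) volume α β := by
  refine intervalIntegrable_of_continuousOn_Ioo hαβ ((by fun_prop : ContinuousOn (fun r : ℝ =>
    r ^ (N - 1)) _).mul hF) (C := β ^ (N - 1) * C) fun r hr => ?_
  have h0 : 0 ≤ r := hα.trans hr.1.le
  have h1 := hr.2.le
  have h2 := hC r hr
  have hβ : 0 ≤ β := h0.trans h1
  rw [abs_mul, abs_of_nonneg (pow_nonneg h0 _)]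
  gcongr

theorem intervalIntegrable_radialForm (hα : 0 ≤ α) (hαβ : α ≤ β) (hf : IsProfile α β f f')
    (hg : IsProfile α β g g') :
    IntervalIntegrable (fun r => r ^ (N - 1) * (f' r * g' r + f r * g r)) volume α β := by
  obtain ⟨A, hA0, hA, hA'⟩ := hf.exists_bound hαβ
  obtain ⟨B, hB0, hB, hB'⟩ := hg.exists_bound hαβ
  refine intervalIntegrable_weight_mul hα hαβ (C := A * B + A * B)
    ((hf.continuousOn_deriv.mul hg.continuousOn_deriv).add
      ((hf.continuousOn.mul hg.continuousOn).mono Set.Ioo_subset_Icc_self)) fun r hr => ?_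
  have hr' := Set.Ioo_subset_Icc_self hr
  refine (abs_add_le _ _).trans (add_le_add ?_ ?_)
  · rw [abs_mul]
    exact mul_le_mul (hA' r hr) (hB' r hr) (abs_nonneg _) hA0
  · rw [abs_mul]
    exact mul_le_mul (hA r hr') (hB r hr') (abs_nonneg _) hA0

theorem radialForm_self_nonneg (hα : 0 ≤ α) (hαβ : α ≤ β) : 0 ≤ radialForm N α β f f' f f' := by
  refine intervalIntegral.integral_nonneg hαβ fun r hr => ?_
  exact mul_nonneg (pow_nonneg (hα.trans hr.1) _)
    (add_nonneg (mul_self_nonneg _) (mul_self_nonneg _))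

/-- Expansion of the energy of `c g + (f - c g)`, when the two parts are orthogonal. -/
theorem radialForm_sub_eq (hα : 0 ≤ α) (hαβ : α ≤ β) (hf : IsProfile α β f f')
    (hg : IsProfile α β g g') {M : ℝ}
    (horth : radialForm N α β g g' (fun r => f r - M * g r) (fun r => f' r - M * g' r) = 0)
    (c : ℝ) :
    radialForm N α β (fun r => f r - c * g r) (fun r => f' r - c * g' r)
        (fun r => f r - c * g r) (fun r => f' r - c * g' r) =
      radialForm N α β (fun r => f r - M * g r) (fun r => f' r - M * g' r)
        (fun r => f r - M * g r) (fun r => f' r - M * g' r) +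
      (M - c) ^ 2 * radialForm N α β g g' g g' := by
  have hd := hf.sub (hg.const_mul M)
  have h1 := intervalIntegrable_radialForm (N := N) hα hαβ hd hd
  have h2 := intervalIntegrable_radialForm (N := N) hα hαβ hg hd
  have h3 := intervalIntegrable_radialForm (N := N) hα hαβ hg hg
  -- Here `f - c g = (f - M g) + (M - c) g`. The case `c = 0` is Pythagoras for `f`, and `c = 1`
  -- measures the distance from `f` to `g`.
  have h4 : radialForm N α β (fun r => f r - c * g r) (fun r => f' r - c * g' r)
        (fun r => f r - c * g r) (fun r => f' r - c * g' r) =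
      radialForm N α β (fun r => f r - M * g r) (fun r => f' r - M * g' r)
        (fun r => f r - M * g r) (fun r => f' r - M * g' r) +
      2 * (M - c) * radialForm N α β g g' (fun r => f r - M * g r) (fun r => f' r - M * g' r) +
      (M - c) ^ 2 * radialForm N α β g g' g g' := by
    simp only [radialForm]
    rw [← intervalIntegral.integral_const_mul, ← intervalIntegral.integral_const_mul,
      ← intervalIntegral.integral_add h1 (h2.const_mul _),
      ← intervalIntegral.integral_add (h1.add (h2.const_mul _)) (h3.const_mul _)]
    exact intervalIntegral.integral_congr fun r _ => by ring
  rw [h4, horth]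
  ring

theorem IsRadialSolution.continuousOn_deriv (hα : 0 ≤ α) (h : IsRadialSolution N α β f f' k P) :
    ContinuousOn f' (Set.Ioo α β) := by
  have h1 : ContinuousOn (fun r => P r / r ^ (N - 1)) (Set.Ioo α β) :=
    (h.continuousOn_flux.mono Set.Ioo_subset_Icc_self).div (by fun_prop)
      fun r hr => (pow_pos (hα.trans_lt hr.1) _).ne'
  refine h1.congr fun r hr => ?_
  change f' r = P r / r ^ (N - 1)
  rw [h.flux_eq r hr, mul_div_cancel_left₀ _ (pow_pos (hα.trans_lt hr.1) _).ne']

/-- By the mean value theorem `r ^ (N - 1) f' r = (r - α) c ^ (N - 1) k c` with `c < r`, so the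
weights cancel even for `α = 0`. Only an upper bound of `k` enters; for `k = f - f ^ p` it can be
taken as `max f`, with no further dependence on `p`. -/
theorem IsRadialSolution.deriv_le_of_flux_left_eq_zero (hα : 0 ≤ α)
    (h : IsRadialSolution N α β f f' k P) (hP : P α = 0) {M : ℝ} (hM : 0 ≤ M)
    (hk : ∀ r ∈ Set.Ioo α β, k r ≤ M) : ∀ r ∈ Set.Ioo α β, f' r ≤ M * β := by
  intro r hr
  have hr0 : 0 < r := hα.trans_lt hr.1
  have hsub : Set.Ioo α r ⊆ Set.Ioo α β := Set.Ioo_subset_Ioo_right hr.2.le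
  obtain ⟨c, hc, hce⟩ := exists_hasDerivAt_eq_slope P (fun s => s ^ (N - 1) * k s) hr.1
    (h.continuousOn_flux.mono (Set.Icc_subset_Icc_right hr.2.le))
    fun s hs => h.hasDerivAt_flux s (hsub hs)
  have hrα : 0 < r - α := sub_pos.2 hr.1
  rw [hP, sub_zero, eq_div_iff hrα.ne', h.flux_eq r hr] at hce
  have hc0 : 0 ≤ c := hα.trans hc.1.le
  have h1 : c ^ (N - 1) * k c * (r - α) ≤ r ^ (N - 1) * M * β := by
    have h2 : c ^ (N - 1) * k c ≤ r ^ (N - 1) * M :=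
      (mul_le_mul_of_nonneg_left (hk c (hsub hc)) (pow_nonneg hc0 _)).trans
        (mul_le_mul_of_nonneg_right (pow_le_pow_left₀ hc0 hc.2.le _) hM)
    refine (mul_le_mul_of_nonneg_right h2 hrα.le).trans ?_
    exact mul_le_mul_of_nonneg_left (by linarith [hr.2]) (by positivity)
  rw [hce, mul_assoc] at h1
  exact le_of_mul_le_mul_left h1 (pow_pos hr0 (N - 1))

/-- Now the intermediate point lies beyond `r`, so the weights do not cancel. The ratio `β ^ (N - 1)
/ α ^ (N - 1)` remains, which requires `α > 0`. -/
theorem IsRadialSolution.neg_deriv_le_of_flux_right_eq_zero (hα : 0 < α)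
    (h : IsRadialSolution N α β f f' k P) (hP : P β = 0) {M : ℝ} (hM : 0 ≤ M)
    (hk : ∀ r ∈ Set.Ioo α β, k r ≤ M) :
    ∀ r ∈ Set.Ioo α β, -f' r ≤ M * (β ^ (N - 1) * β / α ^ (N - 1)) := by
  intro r hr
  have hr0 : 0 < r := hα.trans hr.1
  have hβ : 0 < β := hr0.trans hr.2
  have hsub : Set.Ioo r β ⊆ Set.Ioo α β := Set.Ioo_subset_Ioo_left hr.1.le
  obtain ⟨c, hc, hce⟩ := exists_hasDerivAt_eq_slope P (fun s => s ^ (N - 1) * k s) hr.2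
    (h.continuousOn_flux.mono (Set.Icc_subset_Icc_left hr.1.le))
    fun s hs => h.hasDerivAt_flux s (hsub hs)
  have hrβ : 0 < β - r := sub_pos.2 hr.2
  rw [hP, zero_sub, eq_div_iff hrβ.ne', h.flux_eq r hr] at hce
  have hc0 : 0 ≤ c := hr0.le.trans hc.1.le
  have h1 : c ^ (N - 1) * k c * (β - r) ≤ β ^ (N - 1) * M * β := by
    have h2 : c ^ (N - 1) * k c ≤ β ^ (N - 1) * M :=
      (mul_le_mul_of_nonneg_left (hk c (hsub hc)) (pow_nonneg hc0 _)).trans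
        (mul_le_mul_of_nonneg_right (pow_le_pow_left₀ hc0 hc.2.le _) hM)
    refine (mul_le_mul_of_nonneg_right h2 hrβ.le).trans ?_
    exact mul_le_mul_of_nonneg_left (by linarith) (by positivity)
  rw [hce] at h1
  rw [← mul_div_assoc, le_div_iff₀ (by positivity)]
  have hM' : 0 ≤ β ^ (N - 1) * M * β := by positivity
  by_cases hs : 0 ≤ -f' r
  · calc -f' r * α ^ (N - 1) ≤ -f' r * r ^ (N - 1) := by
          have := hr.1.le
          gcongr
      _ ≤ M * (β ^ (N - 1) * β) := by linarith
  · have : -f' r * α ^ (N - 1) ≤ 0 :=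
      mul_nonpos_of_nonpos_of_nonneg (le_of_not_ge hs) (by positivity)
    linarith

/-- Boundedness of `f'` comes from dividing the bounded flux by `r ^ (N - 1)` when `α > 0`. When the
flux vanishes at `α` it comes from the one-sided derivative bound applied to `f` and to `-f`. -/
theorem IsRadialSolution.isProfile (hα : 0 ≤ α) (hαβ : α < β)
    (h : IsRadialSolution N α β f f' k P) (hP : 0 < α ∨ P α = 0) : IsProfile α β f f' := by
  refine ⟨h.continuousOn, h.hasDerivAt, h.continuousOn_deriv hα, ?_⟩
  rcases hP with hα' | hP
  · obtain ⟨K, hK⟩ := isCompact_Icc.exists_bound_of_continuousOn h.continuousOn_flux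
    refine ⟨K / α ^ (N - 1), fun r hr => ?_⟩
    have h1 := hK r ⟨hr.1.le, hr.2.le⟩
    have hr0 : 0 < r := hα'.trans hr.1
    rw [h.flux_eq r hr, norm_mul, norm_pow, Real.norm_of_nonneg hr0.le, Real.norm_eq_abs] at h1
    rw [le_div_iff₀ (by positivity), mul_comm]
    refine le_trans ?_ h1
    have := hr.1.le
    gcongr
  · obtain ⟨K, hK⟩ := isCompact_Icc.exists_bound_of_continuousOn h.continuousOn_rhs
    have hK0 : 0 ≤ K := (norm_nonneg _).trans (hK α ⟨le_rfl, hαβ.le⟩)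
    have h1 := h.deriv_le_of_flux_left_eq_zero hα hP hK0 fun r hr =>
      (le_abs_self _).trans (hK r ⟨hr.1.le, hr.2.le⟩)
    have h2 := (h.const_mul (-1)).deriv_le_of_flux_left_eq_zero hα (by simp [hP]) hK0 fun r hr => by
      have := (neg_le_abs _).trans (hK r ⟨hr.1.le, hr.2.le⟩)
      linarith
    exact ⟨K * β, fun r hr => abs_le.2 ⟨by linarith [h2 r hr], h1 r hr⟩⟩

/-- Green's formula for a radial solution. -/
theorem IsRadialSolution.integral_eq (hα : 0 ≤ α) (hαβ : α ≤ β)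
    (h : IsRadialSolution N α β f f' k P) (hf : IsProfile α β f f') (hg : IsProfile α β g g') :
    ∫ r in α..β, r ^ (N - 1) * (f' r * g' r + k r * g r) = P β * g β - P α * g α := by
  obtain ⟨A, hA0, -, hA'⟩ := hf.exists_bound hαβ
  obtain ⟨B, hB0, hB, hB'⟩ := hg.exists_bound hαβ
  obtain ⟨K, hK⟩ := isCompact_Icc.exists_bound_of_continuousOn h.continuousOn_rhs
  refine intervalIntegral.integral_eq_sub_of_hasDerivAt_of_le hαβ (f := fun r => P r * g r)
    (h.continuousOn_flux.mul hg.continuousOn) (fun r hr => ?_) ?_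
  · refine ((h.hasDerivAt_flux r hr).mul (hg.hasDerivAt r hr)).congr_deriv ?_
    rw [h.flux_eq r hr]
    ring
  · refine intervalIntegrable_weight_mul hα hαβ (C := A * B + K * B)
      ((hf.continuousOn_deriv.mul hg.continuousOn_deriv).add
        ((h.continuousOn_rhs.mul hg.continuousOn).mono Set.Ioo_subset_Icc_self)) fun r hr => ?_
    have hr' := Set.Ioo_subset_Icc_self hr
    refine (abs_add_le _ _).trans (add_le_add ?_ ?_)
    · rw [abs_mul]
      exact mul_le_mul (hA' r hr) (hB' r hr) (abs_nonneg _) hA0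
    · rw [abs_mul]
      exact mul_le_mul (hK r hr') (hB r hr') (abs_nonneg _) ((norm_nonneg _).trans (hK r hr'))

end ProfileCalculus

/-! ### The `H¹` norm of a radial function -/

section RadialNorm

variable {N : ℕ} {α β : ℝ} {f f' : ℝ → ℝ} {u : EuclideanSpace ℝ (Fin N) → ℝ}

theorem norm_fderiv_of_profile (hα : 0 ≤ α) (hf : IsProfile α β f f')
    (hu : ∀ x ∈ closedAnnulus N α β, u x = f ‖x‖) {x : EuclideanSpace ℝ (Fin N)}
    (hx : x ∈ annulus N α β) (hx0 : x ≠ 0) : ‖fderiv ℝ u x‖ = |f' ‖x‖| := by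
  have h1 : u =ᶠ[𝓝 x] fun y => f ‖y‖ := by
    filter_upwards [isOpen_annulus.mem_nhds hx] with y hy
    exact hu y (annulus_subset_closedAnnulus hα hy)
  have h2 : DifferentiableAt ℝ (fun y : EuclideanSpace ℝ (Fin N) => ‖y‖) x :=
    (contDiffAt_norm ℝ hx0).differentiableAt (n := 1) (by simp)
  have h3 : HasFDerivAt (fun y => f ‖y‖) _ x :=
    (hf.hasDerivAt _ (norm_mem_Ioo_of_mem_annulus hα hx hx0)).comp_hasFDerivAt x h2.hasFDerivAt
  have : Nontrivial (EuclideanSpace ℝ (Fin N)) := ⟨x, 0, hx0⟩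
  rw [h1.fderiv_eq, h3.fderiv, norm_smul, norm_fderiv_norm h2, mul_one, Real.norm_eq_abs]

theorem exists_bound_of_profile (hN : 0 < N) (hα : 0 ≤ α) (hαβ : α < β) (hf : IsProfile α β f f')
    (hu1 : ContDiffOn ℝ 1 u (annulus N α β)) (hu : ∀ x ∈ closedAnnulus N α β, u x = f ‖x‖) :
    ∃ C, ∀ x ∈ annulus N α β, |u x| ≤ C ∧ ‖fderiv ℝ u x‖ ≤ C := by
  have : Nonempty (Fin N) := ⟨⟨0, hN⟩⟩
  obtain ⟨C, hC0, hC, hC'⟩ := hf.exists_bound hαβ.le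
  refine ⟨C, fun x hx => ⟨?_, ?_⟩⟩
  · have hxc := annulus_subset_closedAnnulus hα hx
    rw [hu x hxc]
    exact hC _ hxc
  · have h1 : ∀ y ∈ annulus N α β, y ≠ 0 → ‖fderiv ℝ u y‖ ≤ C := fun y hy hy0 => by
      rw [norm_fderiv_of_profile hα hf hu hy hy0]
      exact hC' _ (norm_mem_Ioo_of_mem_annulus hα hy hy0)
    have hc : ContinuousAt (fderiv ℝ u) x :=
      (continuousOn_fderiv_of_contDiffOn isOpen_annulus hu1).continuousAt
        (isOpen_annulus.mem_nhds hx)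
    have h2 : Tendsto (fun y => ‖fderiv ℝ u y‖) (𝓝[≠] x) (𝓝 ‖fderiv ℝ u x‖) :=
      hc.norm.continuousWithinAt
    -- The norm is not differentiable at the origin, so the bound passes there by continuity of
    -- `fderiv ℝ u`.
    by_cases hx0 : x = 0
    · refine le_of_tendsto h2 ?_
      filter_upwards [self_mem_nhdsWithin, nhdsWithin_le_nhds (isOpen_annulus.mem_nhds hx)]
        with y hy hy'
      exact h1 y hy' (by rwa [hx0] at hy)
    · exact h1 x hx hx0

theorem memH1_of_profile (hN : 0 < N) (hα : 0 ≤ α) (hαβ : α < β) (hf : IsProfile α β f f')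
    (hu1 : ContDiffOn ℝ 1 u (annulus N α β)) (hu : ∀ x ∈ closedAnnulus N α β, u x = f ‖x‖) :
    MemH1 (annulus N α β) u := by
  obtain ⟨C, hC⟩ := exists_bound_of_profile hN hα hαβ hf hu1 hu
  exact ⟨_, hasWeakGradient_gradient isOpen_annulus volume_annulus_ne_top hu1
    (fun x hx => (hC x hx).1) fun x hx => (hC x hx).2⟩

theorem h1Norm_sq_of_profile (hN : 0 < N) (hα : 0 ≤ α) (hαβ : α < β) (hf : IsProfile α β f f')
    (hu1 : ContDiffOn ℝ 1 u (annulus N α β)) (hu : ∀ x ∈ closedAnnulus N α β, u x = f ‖x‖) :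
    h1Norm (annulus N α β) u ^ 2 = sphereArea N * radialForm N α β f f' f f' := by
  have : Nonempty (Fin N) := ⟨⟨0, hN⟩⟩
  obtain ⟨C, hC⟩ := exists_bound_of_profile hN hα hαβ hf hu1 hu
  rw [h1Norm_sq_eq_integral isOpen_annulus volume_annulus_ne_top hu1
    (fun x hx => (hC x hx).1) fun x hx => (hC x hx).2, radialForm,
    ← integral_annulus_comp_norm hN hα hαβ.le fun r => f' r * f' r + f r * f r]
  refine integral_congr_ae ((ae_restrict_iff' isOpen_annulus.measurableSet).2 ?_)
  filter_upwards [Measure.ae_ne volume (0 : EuclideanSpace ℝ (Fin N))] with x hx0 hx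
  rw [norm_fderiv_of_profile hα hf hu hx hx0, hu x (annulus_subset_closedAnnulus hα hx), sq_abs]
  ring

theorem integral_rpow_of_profile (hN : 0 < N) (hα : 0 ≤ α) (hαβ : α < β)
    (hu : ∀ x ∈ closedAnnulus N α β, u x = f ‖x‖) (q : ℝ) :
    ∫ x in annulus N α β, |u x| ^ q = sphereArea N * ∫ r in α..β, r ^ (N - 1) * |f r| ^ q := by
  rw [← integral_annulus_comp_norm hN hα hαβ.le fun r => |f r| ^ q]
  refine setIntegral_congr_fun isOpen_annulus.measurableSet fun x hx => ?_
  simp only [hu x (annulus_subset_closedAnnulus hα hx)]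

end RadialNorm

/-! ### Asymptotics of the quotients as `p → ∞` -/

section Asymptotics

theorem tendsto_one_div_add (s : ℝ) : Tendsto (fun p : ℝ => 1 / (p + s)) atTop (𝓝 0) := by
  simp only [one_div]
  exact (tendsto_atTop_add_const_right atTop s tendsto_id).inv_tendsto_atTop

theorem tendsto_rpow_one_div_add {c : ℝ} (hc : 0 < c) (s : ℝ) :
    Tendsto (fun p : ℝ => c ^ (1 / (p + s))) atTop (𝓝 1) := by
  simpa using tendsto_const_nhds.rpow (tendsto_one_div_add s) (Or.inl hc.ne')

/-- If `X = M² Λ + D` is at most `M ^ (p + 1) V` and has a quotient that is asymptotically at most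
`Λ`, then `M` is close to `1` and `D` is close to `0` for large `p`. -/
theorem eventually_abs_sub_one_lt {Λ V : ℝ} (hΛ : 0 < Λ) (hV : 0 < V) {y : ℝ → ℝ}
    (hy : Tendsto y atTop (𝓝 1)) {ε : ℝ} (hε : 0 < ε) :
    ∀ᶠ p in atTop, ∀ M D X : ℝ, 0 < M → 0 ≤ D → X = M ^ 2 * Λ + D → X ≤ M ^ (p + 1) * V →
      X / (X ^ (1 / (p + 1))) ^ 2 ≤ Λ / y p ^ 2 → |M - 1| < ε ∧ D < ε := by
  -- The quotient bound reads `X ^ (1 - 2 / (p + 1)) ≤ Λ / y p ^ 2`, that is `X ≤ a p`, and `a p →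
  -- Λ`.
  set a : ℝ → ℝ := fun p => (Λ / y p ^ 2) ^ (1 - 2 * (1 / (p + 1)))⁻¹ with ha
  -- From `M ^ 2 Λ ≤ X ≤ M ^ (p + 1) V` one gets `M ^ (p - 1) ≥ Λ / V`, hence `M ≥ m p`, and `m p →
  -- 1`.
  set m : ℝ → ℝ := fun p => (Λ / V) ^ (1 / (p + -1)) with hm
  have hexp : Tendsto (fun p : ℝ => 1 - 2 * (1 / (p + 1))) atTop (𝓝 1) := by
    simpa using (tendsto_const_nhds (x := (1 : ℝ))).sub ((tendsto_one_div_add 1).const_mul 2)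
  have hat : Tendsto a atTop (𝓝 Λ) := by
    have h1 : Tendsto (fun p => Λ / y p ^ 2) atTop (𝓝 Λ) := by
      have h2 : Tendsto (fun p => Λ / y p ^ 2) atTop (𝓝 (Λ / 1 ^ 2)) :=
        tendsto_const_nhds.div (hy.pow 2) (by norm_num)
      rwa [one_pow, div_one] at h2
    have h2 := h1.rpow (hexp.inv₀ one_ne_zero) (Or.inl hΛ.ne')
    rwa [inv_one, Real.rpow_one] at h2
  have hmt : Tendsto m atTop (𝓝 1) := tendsto_rpow_one_div_add (div_pos hΛ hV) (-1)
  have hst : Tendsto (fun p => √(a p / Λ)) atTop (𝓝 1) := by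
    have := (hat.div_const Λ).sqrt
    simpa [hΛ.ne'] using this
  have hDt : Tendsto (fun p => a p - m p ^ 2 * Λ) atTop (𝓝 0) := by
    simpa using hat.sub ((hmt.pow 2).mul_const Λ)
  filter_upwards [eventually_gt_atTop 1, hy.eventually (lt_mem_nhds one_pos),
    hst.eventually (gt_mem_nhds (by linarith : (1 : ℝ) < 1 + ε)),
    hmt.eventually (lt_mem_nhds (by linarith : 1 - ε < (1 : ℝ))),
    hDt.eventually (gt_mem_nhds hε)] with p hp hyp hsp hmp hDp M D X hM hD hX hXV hXq
  have hX0 : 0 < X := by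
    rw [hX]
    positivity
  have hp1 : 0 < p + 1 := by linarith
  have he0 : 0 < 1 - 2 * (1 / (p + 1)) := by
    rw [sub_pos, mul_one_div, div_lt_one hp1]
    linarith
  have hXa : X ≤ a p := by
    have h1 : X / (X ^ (1 / (p + 1))) ^ 2 = X ^ (1 - 2 * (1 / (p + 1))) := by
      rw [Real.rpow_sub hX0, Real.rpow_one, mul_comm 2, Real.rpow_mul hX0.le, Real.rpow_two]
    rw [h1] at hXq
    rw [ha]
    exact (Real.le_rpow_inv_iff_of_pos hX0.le (by positivity) he0).2 hXq
  have hMm : m p ≤ M := by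
    have hp' : 0 < p + -1 := by linarith
    have h1 : M ^ 2 * Λ ≤ M ^ (p + 1) * V := by linarith
    have h2 : M ^ (p + 1) = M ^ 2 * M ^ (p + -1) := by
      rw [← Real.rpow_two, ← Real.rpow_add hM]
      congr 1
      ring
    rw [h2, mul_assoc] at h1
    have h3 : Λ ≤ M ^ (p + -1) * V := le_of_mul_le_mul_left h1 (by positivity)
    rw [hm]
    simp only [one_div]
    exact (Real.rpow_inv_le_iff_of_pos (by positivity) hM.le hp').2 ((div_le_iff₀ hV).2 h3)
  have hMs : M ≤ √(a p / Λ) := by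
    refine Real.le_sqrt_of_sq_le ?_
    rw [le_div_iff₀ hΛ]
    linarith
  have hm0 : 0 ≤ m p := by
    rw [hm]
    positivity
  have hM2 : m p ^ 2 * Λ ≤ M ^ 2 * Λ := by gcongr
  exact ⟨abs_lt.2 ⟨by linarith, by linarith⟩, by linarith⟩

/-- For each `a < 1` the set where `U > a` is open and nonempty, so it has positive measure, and
`q`-th roots of positive constants tend to `1`. The value `1` itself need not be attained in `Ω`. -/
theorem tendsto_lqNorm {N : ℕ} {Ω : Set (EuclideanSpace ℝ (Fin N))} (hΩ : IsOpen Ω)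
    (hfin : volume Ω ≠ ⊤) {U : EuclideanSpace ℝ (Fin N) → ℝ} (hU : ContinuousOn U Ω)
    (hU0 : ∀ x ∈ Ω, 0 ≤ U x) (hU1 : ∀ x ∈ Ω, U x ≤ 1) (hsup : ∀ a < 1, ∃ x ∈ Ω, a < U x) :
    Tendsto (fun p : ℝ => lqNorm (p + 1) Ω U) atTop (𝓝 1) := by
  have hint : ∀ p : ℝ, 0 < p → IntegrableOn (fun x => |U x| ^ (p + 1)) Ω := fun p hp => by
    refine IntegrableOn.of_bound hfin.lt_top ((hU.abs.rpow_const fun x _ =>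
      Or.inr (by linarith)).aestronglyMeasurable hΩ.measurableSet) 1 ?_
    refine (ae_restrict_iff' hΩ.measurableSet).2 (Eventually.of_forall fun x hx => ?_)
    rw [Real.norm_of_nonneg (by positivity), abs_of_nonneg (hU0 x hx)]
    exact Real.rpow_le_one (hU0 x hx) (hU1 x hx) (by linarith)
  have hlow : ∀ a : ℝ, 0 ≤ a → ∀ p : ℝ, 0 < p →
      a * volume.real (Ω ∩ U ⁻¹' Set.Ioi a) ^ (1 / (p + 1)) ≤ lqNorm (p + 1) Ω U := by
    intro a ha p hp
    have hp1 : 0 < p + 1 := by linarith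
    have hopen : IsOpen (Ω ∩ U ⁻¹' Set.Ioi a) := hU.isOpen_inter_preimage hΩ isOpen_Ioi
    have hfin' : volume (Ω ∩ U ⁻¹' Set.Ioi a) ≠ ⊤ :=
      ((measure_mono Set.inter_subset_left).trans_lt hfin.lt_top).ne
    have h1 : a ^ (p + 1) * volume.real (Ω ∩ U ⁻¹' Set.Ioi a) ≤ ∫ x in Ω, |U x| ^ (p + 1) := by
      calc a ^ (p + 1) * volume.real (Ω ∩ U ⁻¹' Set.Ioi a)
          ≤ ∫ x in Ω ∩ U ⁻¹' Set.Ioi a, |U x| ^ (p + 1) := by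
            refine setIntegral_ge_of_const_le_real hopen.measurableSet hfin' (fun x hx => ?_)
              ((hint p hp).mono_set Set.inter_subset_left)
            exact Real.rpow_le_rpow ha ((le_of_lt hx.2).trans (le_abs_self _)) hp1.le
        _ ≤ ∫ x in Ω, |U x| ^ (p + 1) :=
            setIntegral_mono_set (hint p hp) (Eventually.of_forall fun x => by
              simp only [Pi.zero_apply]; positivity)
              (Eventually.of_forall fun x hx => hx.1)
    calc a * volume.real (Ω ∩ U ⁻¹' Set.Ioi a) ^ (1 / (p + 1))
        = (a ^ (p + 1) * volume.real (Ω ∩ U ⁻¹' Set.Ioi a)) ^ (1 / (p + 1)) := by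
          rw [Real.mul_rpow (by positivity) measureReal_nonneg, ← Real.rpow_mul ha,
            mul_one_div_cancel hp1.ne', Real.rpow_one]
      _ ≤ lqNorm (p + 1) Ω U :=
          Real.rpow_le_rpow (mul_nonneg (by positivity) measureReal_nonneg) h1 (by positivity)
  have hpos : ∀ a < 1, 0 < volume.real (Ω ∩ U ⁻¹' Set.Ioi a) := fun a ha => by
    obtain ⟨x, hx, hxa⟩ := hsup a ha
    have hopen : IsOpen (Ω ∩ U ⁻¹' Set.Ioi a) := hU.isOpen_inter_preimage hΩ isOpen_Ioi
    exact ENNReal.toReal_pos (hopen.measure_pos volume ⟨x, hx, hxa⟩).ne'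
      ((measure_mono Set.inter_subset_left).trans_lt hfin.lt_top).ne
  refine tendsto_order.2 ⟨fun b hb => ?_, fun b hb => ?_⟩
  · obtain ⟨a, hab, ha1⟩ := exists_between (max_lt hb one_pos)
    have ha0 : 0 < a := (le_max_right _ _).trans_lt hab
    have h1 := (tendsto_rpow_one_div_add (hpos a ha1) 1).const_mul a
    rw [mul_one] at h1
    filter_upwards [eventually_gt_atTop 0,
      h1.eventually (lt_mem_nhds ((le_max_left _ _).trans_lt hab))] with p hp h2
    exact h2.trans_le (hlow a ha0.le p hp)
  · have hV : 0 < volume.real Ω :=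
      (hpos 0 one_pos).trans_le (measureReal_mono Set.inter_subset_left hfin)
    filter_upwards [eventually_gt_atTop 0,
      (tendsto_rpow_one_div_add hV 1).eventually (gt_mem_nhds hb)] with p hp h2
    refine lt_of_le_of_lt ?_ h2
    refine Real.rpow_le_rpow (integral_nonneg fun x => by positivity) ?_ (by positivity)
    have h3 := setIntegral_mono_on (hint p hp) (integrableOn_const hfin (C := (1 : ℝ)))
      hΩ.measurableSet fun x hx => by
        rw [abs_of_nonneg (hU0 x hx)]
        exact Real.rpow_le_one (hU0 x hx) (hU1 x hx) (by linarith)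
    simpa using h3

end Asymptotics

/-! ### From energy estimates to Hölder estimates -/

section Holder

variable {N : ℕ} {α β : ℝ} {F F' : ℝ → ℝ}

theorem IsProfile.abs_sub_le (hF : IsProfile α β F F') {L : ℝ}
    (hL : ∀ r ∈ Set.Ioo α β, |F' r| ≤ L) {r s : ℝ} (hr : r ∈ Set.Icc α β) (hs : s ∈ Set.Icc α β) :
    |F r - F s| ≤ L * |r - s| := by
  wlog hrs : r < s generalizing r s
  · rcases (not_lt.1 hrs).eq_or_lt with h | h
    · simp [h]
    · rw [abs_sub_comm, abs_sub_comm r]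
      exact this hs hr h
  have hsub : Set.Ioo r s ⊆ Set.Ioo α β := Set.Ioo_subset_Ioo hr.1 hs.2
  obtain ⟨c, hc, hce⟩ := exists_hasDerivAt_eq_slope F F' hrs
    (hF.continuousOn.mono (Set.Icc_subset_Icc hr.1 hs.2)) fun x hx => hF.hasDerivAt x (hsub hx)
  have h0 : s - r ≠ 0 := (sub_pos.2 hrs).ne'
  rw [eq_div_iff h0] at hce
  rw [abs_sub_comm, ← hce, abs_mul, abs_sub_comm s r]
  exact mul_le_mul_of_nonneg_right (hL c (hsub hc)) (abs_nonneg _)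

/-- If `|F r| > ε`, the Lipschitz bound keeps `|F| ≥ ε / 2` on an interval of length `l` next to
`r`. Only its right half is used, where the weight is at least `(l / 2) ^ (N - 1)` even if the
interval starts at the origin. -/
theorem exists_energy_bound_imp_sup_bound (N : ℕ) (hα : 0 ≤ α) (hαβ : α < β) {L ε : ℝ}
    (hL : 0 < L) (hε : 0 < ε) : ∃ δ > 0, ∀ F F' : ℝ → ℝ, IsProfile α β F F' →
      (∀ r ∈ Set.Ioo α β, |F' r| ≤ L) → radialForm N α β F F' F F' < δ →
      ∀ r ∈ Set.Icc α β, |F r| ≤ ε := by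
  set l := min (ε / (2 * L)) ((β - α) / 2) with hl
  have hβα : 0 < β - α := sub_pos.2 hαβ
  have hl0 : 0 < l := lt_min (by positivity) (by positivity)
  have hlL : L * l ≤ ε / 2 := by
    have h1 : l ≤ ε / (2 * L) := min_le_left _ _
    rw [le_div_iff₀ (by positivity)] at h1
    linarith
  have hlβ : l ≤ (β - α) / 2 := min_le_right _ _
  refine ⟨(l / 2) ^ (N - 1) * (ε / 2) ^ 2 * (l / 2), by positivity,
    fun F F' hF hF' hE r hr => ?_⟩
  by_contra! hbig
  -- The interval is placed to the right of `r` if it fits and to the left otherwise; `l ≤ (β - α) /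
  -- 2` leaves room on one side.
  obtain ⟨a, haα, haβ, hra⟩ : ∃ a, α ≤ a ∧ a + l ≤ β ∧ ∀ s ∈ Set.Icc a (a + l), |r - s| ≤ l := by
    by_cases h : r + l ≤ β
    · exact ⟨r, hr.1, h, fun s hs => abs_le.2 ⟨by linarith [hs.2], by linarith [hs.1]⟩⟩
    · exact ⟨r - l, by linarith, by linarith [hr.2],
        fun s hs => abs_le.2 ⟨by linarith [hs.2], by linarith [hs.1]⟩⟩
  have hi := intervalIntegrable_radialForm (N := N) hα hαβ.le hF hF
  have hsub : Set.uIcc (a + l / 2) (a + l) ⊆ Set.uIcc α β := by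
    rw [Set.uIcc_of_le (by linarith), Set.uIcc_of_le hαβ.le]
    exact Set.Icc_subset_Icc (by linarith) haβ
  have h1 : ∫ s in (a + l / 2)..(a + l), s ^ (N - 1) * (F' s * F' s + F s * F s) ≤
      radialForm N α β F F' F F' := by
    refine intervalIntegral.integral_mono_interval (by linarith) (by linarith) haβ ?_ hi
    refine (ae_restrict_iff' measurableSet_Ioc).2 (Eventually.of_forall fun s hs => ?_)
    exact mul_nonneg (pow_nonneg (hα.trans hs.1.le) _)
      (add_nonneg (mul_self_nonneg _) (mul_self_nonneg _))
  have h2 : ∫ _s in (a + l / 2)..(a + l), (l / 2) ^ (N - 1) * (ε / 2) ^ 2 ≤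
      ∫ s in (a + l / 2)..(a + l), s ^ (N - 1) * (F' s * F' s + F s * F s) := by
    refine intervalIntegral.integral_mono_on (by linarith) (by simp) (hi.mono_set hsub)
      fun s hs => ?_
    have hsa : s ∈ Set.Icc a (a + l) := ⟨by linarith [hs.1], hs.2⟩
    have hs' : s ∈ Set.Icc α β := ⟨haα.trans hsa.1, hsa.2.trans haβ⟩
    have h3 := hF.abs_sub_le hF' hr hs'
    have h4 : L * |r - s| ≤ L * l := mul_le_mul_of_nonneg_left (hra s hsa) hL.le
    have h5 : ε / 2 ≤ |F s| := by
      have := abs_sub_abs_le_abs_sub (F r) (F s)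
      linarith
    have h6 : (ε / 2) ^ 2 ≤ F' s * F' s + F s * F s := by
      have h7 : (ε / 2) ^ 2 ≤ |F s| ^ 2 := by gcongr
      rw [sq_abs] at h7
      nlinarith [mul_self_nonneg (F' s)]
    have h8 : l / 2 ≤ s := by linarith [hs.1]
    have h9 : 0 ≤ s := by linarith
    gcongr
  rw [intervalIntegral.integral_const, smul_eq_mul] at h2
  nlinarith

/-- Interpolation: a difference `d` is written `|d| ^ γ |d| ^ (1 - γ)`, with the Lipschitz bound on
the first factor and `2 η` on the second. Since `|‖x‖ - ‖y‖| ≤ ‖x - y‖`, no path inside the annulus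
is needed. -/
theorem holderNorm_le_of_profile {γ : ℝ≥0} (hγ1 : γ ≤ 1)
    {w : EuclideanSpace ℝ (Fin N) → ℝ} (hF : IsProfile α β F F')
    (hw : ∀ x ∈ closedAnnulus N α β, w x = F ‖x‖) {L η : ℝ} (hL0 : 0 ≤ L)
    (hL : ∀ r ∈ Set.Ioo α β, |F' r| ≤ L) (hη0 : 0 ≤ η) (hη : ∀ r ∈ Set.Icc α β, |F r| ≤ η) :
    holderNorm γ (closedAnnulus N α β) w ≤
      ENNReal.ofReal (η + L ^ (γ : ℝ) * (2 * η) ^ (1 - (γ : ℝ))) := by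
  rw [ENNReal.ofReal_add hη0 (by positivity)]
  refine add_le_add ?_ ?_
  · refine iSup₂_le fun x hx => ?_
    rw [hw x hx, Real.enorm_eq_ofReal_abs]
    exact ENNReal.ofReal_le_ofReal (hη _ hx)
  · refine (HolderWith.eHolderNorm_le (C := Real.toNNReal (L ^ (γ : ℝ) * (2 * η) ^ (1 - (γ : ℝ))))
      ?_)
    intro x y
    have hx := x.2
    have hy := y.2
    have h1 : |w x - w y| ≤ L * dist x y := by
      rw [hw x hx, hw y hy]
      refine (hF.abs_sub_le hL hx hy).trans (mul_le_mul_of_nonneg_left ?_ hL0)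
      exact abs_norm_sub_norm_le _ _ |>.trans_eq (dist_eq_norm _ _).symm
    have h2 : |w x - w y| ≤ 2 * η := by
      rw [hw x hx, hw y hy]
      exact (abs_sub _ _).trans (by linarith [hη _ hx, hη _ hy])
    have h3 : |w x - w y| ≤ L ^ (γ : ℝ) * (2 * η) ^ (1 - (γ : ℝ)) * dist x y ^ (γ : ℝ) := by
      have hγ1' : (γ : ℝ) ≤ 1 := by exact_mod_cast hγ1
      calc |w x - w y| = |w x - w y| ^ (γ : ℝ) * |w x - w y| ^ (1 - (γ : ℝ)) := by
            rw [← Real.rpow_add_of_nonneg (abs_nonneg _) γ.coe_nonneg (by linarith), add_sub_cancel,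
              Real.rpow_one]
        _ ≤ (L * dist x y) ^ (γ : ℝ) * (2 * η) ^ (1 - (γ : ℝ)) := by
            gcongr
        _ = _ := by
            rw [Real.mul_rpow hL0 dist_nonneg]
            ring
    rw [edist_dist, edist_dist, Real.dist_eq,
      ENNReal.ofReal_rpow_of_nonneg dist_nonneg γ.coe_nonneg]
    change ENNReal.ofReal |w x - w y| ≤ ENNReal.ofReal _ * _
    rw [← ENNReal.ofReal_mul (by positivity)]
    exact ENNReal.ofReal_le_ofReal h3

theorem exists_pos_add_rpow_lt {L c ε : ℝ} (hc : 0 < c) (hε : 0 < ε) :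
    ∃ η > 0, η + L * (2 * η) ^ c < ε := by
  have h1 : ContinuousAt (fun η : ℝ => η + L * (2 * η) ^ c) 0 :=
    continuousAt_id.add (continuousAt_const.mul
      (ContinuousAt.rpow_const (by fun_prop) (Or.inr hc.le)))
  have h2 : Tendsto (fun η : ℝ => η + L * (2 * η) ^ c) (𝓝[>] 0) (𝓝 0) := by
    have := h1.tendsto
    simp only [mul_zero, Real.zero_rpow hc.ne', add_zero] at this
    exact this.mono_left nhdsWithin_le_nhds
  obtain ⟨η, h3, h4⟩ := ((h2.eventually (gt_mem_nhds hε)).and self_mem_nhdsWithin).exists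
  exact ⟨η, h4, h3⟩

end Holder

/-! ### Convergence -/

section Convergence

variable {N : ℕ} {α β p : ℝ}

/-- `u` is radial with the `C¹` profile `f`. -/
structure HasProfile (N : ℕ) (α β : ℝ) (u : EuclideanSpace ℝ (Fin N) → ℝ) (f f' : ℝ → ℝ) :
    Prop where
  contDiffOn : ContDiffOn ℝ 1 u (annulus N α β)
  eq_comp_norm : ∀ x ∈ closedAnnulus N α β, u x = f ‖x‖
  isProfile : IsProfile α β f f'

theorem HasProfile.sub {u v : EuclideanSpace ℝ (Fin N) → ℝ} {f f' g g' : ℝ → ℝ}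
    (hu : HasProfile N α β u f f') (hv : HasProfile N α β v g g') :
    HasProfile N α β (u - v) (fun r => f r - g r) fun r => f' r - g' r :=
  ⟨hu.contDiffOn.sub hv.contDiffOn, fun x hx => by
    rw [Pi.sub_apply, hu.eq_comp_norm x hx, hv.eq_comp_norm x hx], hu.isProfile.sub hv.isProfile⟩

theorem HasProfile.smul {u : EuclideanSpace ℝ (Fin N) → ℝ} {f f' : ℝ → ℝ}
    (hu : HasProfile N α β u f f') (t : ℝ) :
    HasProfile N α β (t • u) (fun r => t * f r) fun r => t * f' r :=
  ⟨hu.contDiffOn.const_smul t, fun x hx => by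
    rw [Pi.smul_apply, hu.eq_comp_norm x hx, smul_eq_mul], hu.isProfile.const_mul t⟩

/-- A nonnegative radial function of maximum `M`, with the properties of the solutions `u_p` that
force its convergence to the function of profile `g`. -/
structure IsNearMinimizer (N : ℕ) (α β p C : ℝ) (U : EuclideanSpace ℝ (Fin N) → ℝ) (g g' : ℝ → ℝ)
    (u : EuclideanSpace ℝ (Fin N) → ℝ) (f f' : ℝ → ℝ) (M : ℝ) : Prop where
  hasProfile : HasProfile N α β u f f'
  pos : 0 < M
  nonneg : ∀ r ∈ Set.Icc α β, 0 ≤ f r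
  le : ∀ r ∈ Set.Icc α β, f r ≤ M
  deriv_le : ∀ r ∈ Set.Ioo α β, |f' r| ≤ M * C
  energy_eq : radialForm N α β f f' f f' = ∫ r in α..β, r ^ (N - 1) * |f r| ^ (p + 1)
  orthogonal : radialForm N α β g g' (fun r => f r - M * g r) (fun r => f' r - M * g' r) = 0
  quotient_le : quotientQ N α β p u ≤ quotientQ N α β p U

theorem eventually_energy_lt (hN : 0 < N) (hα : 0 ≤ α) (hαβ : α < β)
    {U : EuclideanSpace ℝ (Fin N) → ℝ} {g g' : ℝ → ℝ} (hU : HasProfile N α β U g g')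
    (hlim : Tendsto (fun p => lqNorm (p + 1) (annulus N α β) U) atTop (𝓝 1))
    (hg : 0 < radialForm N α β g g' g g') {C ε : ℝ} (hε : 0 < ε) :
    ∀ᶠ p in atTop, ∀ u f f' M, IsNearMinimizer N α β p C U g g' u f f' M →
      M < 2 ∧ radialForm N α β (fun r => f r - g r) (fun r => f' r - g' r)
        (fun r => f r - g r) (fun r => f' r - g' r) < ε := by
  have hσ := sphereArea_pos hN
  set Λ := radialForm N α β g g' g g' with hΛ
  have hV : 0 < volume.real (annulus N α β) := by
    have : Nonempty (Fin N) := ⟨⟨0, hN⟩⟩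
    obtain ⟨x, hx⟩ := NormedSpace.exists_lt_norm ℝ (EuclideanSpace ℝ (Fin N)) 0
    have hmid : (α + β) / 2 ∈ Set.Ioo α β := ⟨by linarith, by linarith⟩
    have h0 : 0 ≤ (α + β) / 2 := hα.trans hmid.1.le
    refine ENNReal.toReal_pos (isOpen_annulus.measure_pos volume
      ⟨((α + β) / 2) • (‖x‖⁻¹ • x), mem_annulus_of_norm_mem_Ioo ?_⟩).ne' volume_annulus_ne_top
    rwa [norm_smul, norm_smul, norm_inv, norm_norm, inv_mul_cancel₀ hx.ne', mul_one,
      Real.norm_of_nonneg h0]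
  -- The bound `1` gives `M < 2` and `(M - 1) ^ 2 ≤ |M - 1|`; the other two give half of `ε` each to
  -- `D` and to `(M - 1) ^ 2 Λ`.
  set η := min (min 1 (sphereArea N * (ε / 2))) (min 1 (ε / (2 * Λ))) with hη
  have hη0 : 0 < η := by
    refine lt_min (lt_min one_pos (by positivity)) (lt_min one_pos (by positivity))
  filter_upwards [eventually_abs_sub_one_lt (mul_pos hσ hg) hV hlim hη0, eventually_gt_atTop 0]
    with p hp hp0 u f f' M h
  have hgp := hU.isProfile
  have hfp := h.hasProfile.isProfile
  set D := radialForm N α β (fun r => f r - M * g r) (fun r => f' r - M * g' r)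
    (fun r => f r - M * g r) (fun r => f' r - M * g' r) with hD
  have hD0 : 0 ≤ D := radialForm_self_nonneg hα hαβ.le
  have hH := h1Norm_sq_of_profile hN hα hαβ hfp h.hasProfile.contDiffOn h.hasProfile.eq_comp_norm
  have hHU := h1Norm_sq_of_profile hN hα hαβ hgp hU.contDiffOn hU.eq_comp_norm
  have hX := integral_rpow_of_profile hN hα hαβ h.hasProfile.eq_comp_norm (p + 1)
  have hq := h.quotient_le
  rw [quotientQ, quotientQ, hH, hHU, h.energy_eq, ← hX] at hq
  have h0 := radialForm_sub_eq hα hαβ.le hfp hgp h.orthogonal 0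
  have h1 := radialForm_sub_eq hα hαβ.le hfp hgp h.orthogonal 1
  simp only [zero_mul, sub_zero, one_mul] at h0 h1
  rw [h1]
  have hXV : ∫ x in annulus N α β, |u x| ^ (p + 1) ≤
      M ^ (p + 1) * volume.real (annulus N α β) := by
    have hb : ∀ x ∈ annulus N α β, ‖|u x| ^ (p + 1)‖ ≤ M ^ (p + 1) := fun x hx => by
      have hxc := annulus_subset_closedAnnulus hα hx
      rw [Real.norm_of_nonneg (by positivity), h.hasProfile.eq_comp_norm x hxc,
        abs_of_nonneg (h.nonneg _ hxc)]
      exact Real.rpow_le_rpow (h.nonneg _ hxc) (h.le _ hxc) (by linarith)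
    exact (le_abs_self _).trans
      (norm_setIntegral_le_of_norm_le_const volume_annulus_ne_top.lt_top hb)
  have hXe : ∫ x in annulus N α β, |u x| ^ (p + 1) =
      M ^ 2 * (sphereArea N * Λ) + sphereArea N * D := by
    rw [hX, ← h.energy_eq, h0]
    ring
  obtain ⟨h2, h3⟩ := hp M (sphereArea N * D) _ h.pos (by positivity) hXe hXV hq
  have h4 : η ≤ 1 := (min_le_right _ _).trans (min_le_left _ _)
  have h5 : η ≤ sphereArea N * (ε / 2) := (min_le_left _ _).trans (min_le_right _ _)
  have h6 : η ≤ ε / (2 * Λ) := (min_le_right _ _).trans (min_le_right _ _)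
  have h7 : D < ε / 2 := lt_of_mul_lt_mul_left (h3.trans_le h5) hσ.le
  have h8 : (M - 1) ^ 2 ≤ |M - 1| := by
    rw [← sq_abs]
    nlinarith [abs_nonneg (M - 1)]
  have h9 : (M - 1) ^ 2 * Λ ≤ ε / 2 := by
    rw [le_div_iff₀ (by positivity)] at h6
    nlinarith
  exact ⟨by linarith [(abs_lt.1 h2).2], by linarith⟩

theorem convergesTo_of_isNearMinimizer (hN : 0 < N) (hα : 0 ≤ α) (hαβ : α < β)
    {U : EuclideanSpace ℝ (Fin N) → ℝ} {g g' : ℝ → ℝ} (hU : HasProfile N α β U g g')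
    (hlim : Tendsto (fun p => lqNorm (p + 1) (annulus N α β) U) atTop (𝓝 1))
    (hg : 0 < radialForm N α β g g' g g') {C : ℝ} (hC : 0 ≤ C)
    {S : ℝ → Set (EuclideanSpace ℝ (Fin N) → ℝ)}
    (hS : ∀ p > 1, ∀ u ∈ S p, ∃ f f' M, IsNearMinimizer N α β p C U g g' u f f' M) :
    ConvergesTo N α β S U := by
  have hσ := sphereArea_pos hN
  refine ⟨fun ε hε => ?_, fun γ hγ0 hγ1 ε hε => ?_⟩
  · filter_upwards [eventually_energy_lt hN hα hαβ hU hlim hg (C := C)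
      (div_pos (pow_pos hε 2) hσ), eventually_gt_atTop 1] with p hp hp1 u hu
    obtain ⟨f, f', M, h⟩ := hS p hp1 u hu
    have hd := h.hasProfile.sub hU
    refine ⟨memH1_of_profile hN hα hαβ hd.isProfile hd.contDiffOn hd.eq_comp_norm, ?_⟩
    have h1 := h1Norm_sq_of_profile hN hα hαβ hd.isProfile hd.contDiffOn hd.eq_comp_norm
    have h2 := (hp u f f' M h).2
    rw [lt_div_iff₀ hσ, mul_comm, ← h1] at h2
    exact lt_of_pow_lt_pow_left₀ 2 hε.le h2
  · obtain ⟨B, hB0, -, hB⟩ := hU.isProfile.exists_bound hαβ.le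
    -- Since `M < 2` eventually, `2 C` bounds `|f'|`, and `B` bounds `|g'|`; the `1` makes `L`
    -- positive.
    set L := 2 * C + B + 1 with hL
    have hL0 : 0 < L := by positivity
    have hγ : 0 < 1 - (γ : ℝ) := sub_pos.2 (by exact_mod_cast hγ1)
    obtain ⟨η, hη0, hη⟩ := exists_pos_add_rpow_lt (L := L ^ (γ : ℝ)) hγ hε
    obtain ⟨δ, hδ0, hδ⟩ := exists_energy_bound_imp_sup_bound N hα hαβ hL0 hη0
    filter_upwards [eventually_energy_lt hN hα hαβ hU hlim hg (C := C) hδ0,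
      eventually_gt_atTop 1] with p hp hp1 u hu
    obtain ⟨f, f', M, h⟩ := hS p hp1 u hu
    have hd := h.hasProfile.sub hU
    obtain ⟨hM, hE⟩ := hp u f f' M h
    have hLd : ∀ r ∈ Set.Ioo α β, |f' r - g' r| ≤ L := fun r hr => by
      have h1 := h.deriv_le r hr
      have h2 := hB r hr
      have h3 : M * C ≤ 2 * C := mul_le_mul_of_nonneg_right hM.le hC
      have h4 := abs_sub (f' r) (g' r)
      linarith
    have hsup := hδ _ _ hd.isProfile hLd hE
    refine (holderNorm_le_of_profile hγ1.le hd.isProfile hd.eq_comp_norm hL0.le hLd hη0.le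
      hsup).trans_lt ?_
    exact (ENNReal.ofReal_lt_ofReal_iff hε).2 hη

end Convergence

/-! ### The increasing and the decreasing solutions -/

section Solutions

variable {N : ℕ} {α β p : ℝ}

theorem exists_mem_closedAnnulus_norm_eq (hN : 0 < N) (hα : 0 ≤ α) {r : ℝ} (hr : r ∈ Set.Icc α β) :
    ∃ x ∈ closedAnnulus N α β, ‖x‖ = r := by
  have hx : ‖EuclideanSpace.single (⟨0, hN⟩ : Fin N) r‖ = r := by
    rw [PiLp.norm_single, Real.norm_of_nonneg (hα.trans hr.1)]
  exact ⟨_, by rw [closedAnnulus, Set.mem_ofPred_eq, hx]; exact hr, hx⟩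

theorem quotientQ_nonneg (u : EuclideanSpace ℝ (Fin N) → ℝ) : 0 ≤ quotientQ N α β p u := by
  unfold quotientQ
  positivity

/-- Only a multiple of a solution is known to be a minimizer; this invariance passes the bound on
the quotient to the solution itself. -/
theorem quotientQ_smul (hN : 0 < N) (hα : 0 ≤ α) (hαβ : α < β) (hp : 0 < p)
    {u : EuclideanSpace ℝ (Fin N) → ℝ} {f f' : ℝ → ℝ} (hu : HasProfile N α β u f f') {t : ℝ}
    (ht : 0 < t) : quotientQ N α β p (t • u) = quotientQ N α β p u := by
  have hp1 : p + 1 ≠ 0 := by linarith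
  have h1 := h1Norm_sq_of_profile hN hα hαβ hu.isProfile hu.contDiffOn hu.eq_comp_norm
  have h2 := h1Norm_sq_of_profile hN hα hαβ (hu.smul t).isProfile (hu.smul t).contDiffOn
    (hu.smul t).eq_comp_norm
  have h3 : radialForm N α β (fun r => t * f r) (fun r => t * f' r) (fun r => t * f r)
      (fun r => t * f' r) = t ^ 2 * radialForm N α β f f' f f' := by
    simp only [radialForm]
    rw [← intervalIntegral.integral_const_mul]
    exact intervalIntegral.integral_congr fun r _ => by ring
  have h4 : lqNorm (p + 1) (annulus N α β) (t • u) = t * lqNorm (p + 1) (annulus N α β) u := by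
    have h5 : ∫ x in annulus N α β, |(t • u) x| ^ (p + 1) =
        t ^ (p + 1) * ∫ x in annulus N α β, |u x| ^ (p + 1) := by
      rw [← integral_const_mul]
      refine integral_congr_ae (Eventually.of_forall fun x => ?_)
      simp only [Pi.smul_apply, smul_eq_mul]
      rw [abs_mul, abs_of_pos ht, Real.mul_rpow ht.le (abs_nonneg _)]
    rw [lqNorm, lqNorm, h5, Real.mul_rpow (by positivity)
      (integral_nonneg fun x => by positivity), ← Real.rpow_mul ht.le, mul_one_div_cancel hp1,
      Real.rpow_one]
  rw [quotientQ, quotientQ, h4, h2, h3, mul_pow, mul_left_comm, ← h1,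
    mul_div_mul_left _ _ (by positivity)]

/-- This is Green's formula with the solution as its own test function; both boundary fluxes vanish.
-/
theorem IsRadialSolution.radialForm_self_eq (hα : 0 ≤ α) (hαβ : α < β) (hp : 0 < p)
    {f f' P : ℝ → ℝ} (h : IsRadialSolution N α β f f' (fun r => f r - f r ^ p) P)
    (hf : IsProfile α β f f') (h0 : ∀ r ∈ Set.Icc α β, 0 ≤ f r) (hPα : P α = 0) (hPβ : P β = 0) :
    radialForm N α β f f' f f' = ∫ r in α..β, r ^ (N - 1) * |f r| ^ (p + 1) := by
  have h1 := h.integral_eq hα hαβ.le hf hf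
  rw [hPα, hPβ, zero_mul, zero_mul, sub_zero] at h1
  have hint : IntervalIntegrable (fun r => r ^ (N - 1) * |f r| ^ (p + 1)) volume α β := by
    refine ContinuousOn.intervalIntegrable ?_
    rw [Set.uIcc_of_le hαβ.le]
    exact (by fun_prop : ContinuousOn (fun r : ℝ => r ^ (N - 1)) _).mul
      (hf.continuousOn.abs.rpow_const fun _ _ => Or.inr (by linarith))
  rw [← sub_eq_zero, radialForm, ← intervalIntegral.integral_sub
    (intervalIntegrable_radialForm hα hαβ.le hf hf) hint, ← h1]
  refine intervalIntegral.integral_congr fun r hr => ?_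
  rw [Set.uIcc_of_le hαβ.le] at hr
  change r ^ (N - 1) * (f' r * f' r + f r * f r) - r ^ (N - 1) * |f r| ^ (p + 1) =
    r ^ (N - 1) * (f' r * f' r + (f r - f r ^ p) * f r)
  rw [abs_of_nonneg (h0 r hr), Real.rpow_add_one' (h0 r hr) (by linarith)]
  ring

theorem radialForm_self_pos (hα : 0 ≤ α) (hαβ : α < β) {g g' : ℝ → ℝ} (hg : IsProfile α β g g')
    (hpos : ∀ r ∈ Set.Icc α β, 0 < g r) : 0 < radialForm N α β g g' g g' := by
  refine intervalIntegral.intervalIntegral_pos_of_pos_on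
    (intervalIntegrable_radialForm hα hαβ.le hg hg) (fun r hr => ?_) hαβ
  have h1 := hpos r ⟨hr.1.le, hr.2.le⟩
  have h2 : 0 < r := hα.trans_lt hr.1
  exact mul_pos (by positivity) (add_pos_of_nonneg_of_pos (mul_self_nonneg _) (by positivity))

theorem IsProfile.deriv_nonneg_of_monotoneOn {f f' : ℝ → ℝ} (hf : IsProfile α β f f')
    (hmono : MonotoneOn f (Set.Icc α β)) : ∀ r ∈ Set.Ioo α β, 0 ≤ f' r := by
  intro r hr
  have h1 := (hmono.mono Set.Ioo_subset_Icc_self).derivWithin_nonneg (x := r)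
  rwa [(hf.hasDerivAt r hr).hasDerivWithinAt.derivWithin (isOpen_Ioo.uniqueDiffOn r hr)] at h1

theorem IsProfile.deriv_nonpos_of_antitoneOn {f f' : ℝ → ℝ} (hf : IsProfile α β f f')
    (hanti : AntitoneOn f (Set.Icc α β)) : ∀ r ∈ Set.Ioo α β, f' r ≤ 0 := by
  intro r hr
  have h1 := (hanti.mono Set.Ioo_subset_Icc_self).derivWithin_nonpos (x := r)
  rwa [(hf.hasDerivAt r hr).hasDerivWithinAt.derivWithin (isOpen_Ioo.uniqueDiffOn r hr)] at h1

theorem tendsto_lqNorm_of_profile (hN : 0 < N) (hα : 0 ≤ α) (hαβ : α < β)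
    {U : EuclideanSpace ℝ (Fin N) → ℝ} {g g' : ℝ → ℝ} (hU : HasProfile N α β U g g')
    (h0 : ∀ r ∈ Set.Icc α β, 0 ≤ g r) (h1 : ∀ r ∈ Set.Icc α β, g r ≤ 1) {b : ℝ}
    (hb : b ∈ Set.Icc α β) (hgb : g b = 1) :
    Tendsto (fun p => lqNorm (p + 1) (annulus N α β) U) atTop (𝓝 1) := by
  refine tendsto_lqNorm isOpen_annulus volume_annulus_ne_top hU.contDiffOn.continuousOn
    (fun x hx => ?_) (fun x hx => ?_) fun a ha => ?_
  · have hxc := annulus_subset_closedAnnulus hα hx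
    rw [hU.eq_comp_norm x hxc]
    exact h0 _ hxc
  · have hxc := annulus_subset_closedAnnulus hα hx
    rw [hU.eq_comp_norm x hxc]
    exact h1 _ hxc
  · have hcl : b ∈ closure (Set.Ioo α β) := by rwa [closure_Ioo hαβ.ne]
    have hne : (𝓝[Set.Ioo α β] b).NeBot := mem_closure_iff_nhdsWithin_neBot.1 hcl
    have ht : Tendsto g (𝓝[Set.Ioo α β] b) (𝓝 1) :=
      hgb ▸ (hU.isProfile.continuousOn b hb).mono Set.Ioo_subset_Icc_self
    obtain ⟨r, hr, hr'⟩ := ((ht.eventually (lt_mem_nhds ha)).and self_mem_nhdsWithin).exists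
    obtain ⟨x, hx, hxr⟩ := exists_mem_closedAnnulus_norm_eq hN hα ⟨hr'.1.le, hr'.2.le⟩
    refine ⟨x, mem_annulus_of_norm_mem_Ioo (hxr ▸ hr'), ?_⟩
    rwa [hU.eq_comp_norm x hx, hxr]

theorem memH1Rad_of_profile (hN : 0 < N) (hα : 0 ≤ α) (hαβ : α < β)
    {U : EuclideanSpace ℝ (Fin N) → ℝ} {g g' : ℝ → ℝ} (hU : HasProfile N α β U g g')
    (hc : ContinuousOn U (closedAnnulus N α β)) : MemH1Rad N α β U :=
  ⟨memH1_of_profile hN hα hαβ hU.isProfile hU.contDiffOn hU.eq_comp_norm, hc,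
    fun x hx y hy hxy => by rw [hU.eq_comp_norm x hx, hU.eq_comp_norm y hy, hxy]⟩

/-- A solution of the Neumann problem whose profile has its maximum at the end `b`, where the limit
profile takes the value `1`. -/
theorem isNearMinimizer_of_solvesNeumann (hα : 0 ≤ α) (hαβ : α < β) (hp : 0 < p) {C b : ℝ}
    {U u : EuclideanSpace ℝ (Fin N) → ℝ} {g g' P f f' Q : ℝ → ℝ}
    (hg : IsRadialSolution N α β g g' g P) (hU : HasProfile N α β U g g') (hgb : g b = 1)
    (hb : b = β ∧ P α = 0 ∨ b = α ∧ P β = 0) (hu : SolvesNeumann N α β p u)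
    (huf : ∀ x ∈ closedAnnulus N α β, u x = f ‖x‖)
    (hf : IsRadialSolution N α β f f' (fun r => f r - f r ^ p) Q) (hQα : Q α = 0) (hQβ : Q β = 0)
    (h0 : ∀ r ∈ Set.Icc α β, 0 ≤ f r) (hle : ∀ r ∈ Set.Icc α β, f r ≤ f b) (hpos : 0 < f b)
    (hder : ∀ r ∈ Set.Ioo α β, |f' r| ≤ f b * C)
    (hquot : quotientQ N α β p u ≤ quotientQ N α β p U) :
    IsNearMinimizer N α β p C U g g' u f f' (f b) := by
  have hfp : IsProfile α β f f' := hf.isProfile hα hαβ (Or.inr hQα)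
  refine ⟨⟨hu.solves.contDiffOn.of_le (by norm_num), huf, hfp⟩, hpos, h0, hle, hder,
    hf.radialForm_self_eq hα hαβ hp hfp h0 hQα hQβ, ?_, hquot⟩
  -- In Green's formula for `g`, the boundary term at `b` vanishes because `f b - f b * g b = 0`,
  -- and the one at the other end because the flux of `g` is zero there.
  have h1 := hg.integral_eq hα hαβ.le hU.isProfile (hfp.sub (hU.isProfile.const_mul (f b)))
  rw [radialForm, h1]
  rcases hb with ⟨rfl, hP⟩ | ⟨rfl, hP⟩ <;> rw [hP, hgb] <;> ring

theorem rhs_le_of_nonneg {s M : ℝ} (hs : 0 ≤ s) (hM : s ≤ M) : s - s ^ p ≤ M :=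
  (sub_le_self _ (Real.rpow_nonneg hs p)).trans hM

theorem exists_limitPlus (hN : 2 ≤ N) (hα : 0 ≤ α) (hαβ : α < β) :
    ∃ U : EuclideanSpace ℝ (Fin N) → ℝ, SolvesLimitPlus N α β U ∧
      (∀ V, SolvesLimitPlus N α β V → Set.EqOn V U (closedAnnulus N α β)) ∧
      MemH1 (annulus N α β) U ∧
      ConvergesTo N α β (fun p => {u | IsIncreasingSolution N α β p u}) U := by
  have hN0 : 0 < N := by omega
  have hβ : 0 < β := hα.trans_lt hαβ
  have hβm : β ∈ Set.Icc α β := ⟨hαβ.le, le_rfl⟩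
  obtain ⟨g, g', P, hsol, hrad, hP, hgβ, hgpos, hgmono⟩ := exists_solvesLimitPlus hN hα hαβ
  set U : EuclideanSpace ℝ (Fin N) → ℝ := fun x => g ‖x‖ with hUdef
  have hU : HasProfile N α β U g g' :=
    ⟨hsol.solves.contDiffOn.of_le (by norm_num), fun _ _ => rfl,
      hrad.isProfile hα hαβ (Or.inr hP)⟩
  have hg1 : ∀ r ∈ Set.Icc α β, g r ≤ 1 := fun r hr => hgβ ▸ hgmono hr hβm hr.2
  have hUmem : MemH1Rad N α β U := memH1Rad_of_profile hN0 hα hαβ hU hsol.solves.continuousOn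
  have hUcomp : U ∈ increasingCompetitors N α β := by
    refine ⟨⟨hUmem, fun x hx => (hgpos _ hx).le, fun x hx y hy hxy => hgmono hx hy hxy⟩, ?_, ?_⟩
    · obtain ⟨x, hx, hxβ⟩ := exists_mem_closedAnnulus_norm_eq hN0 hα hβm
      exact ⟨x, hx, (hgpos _ hx).ne'⟩
    -- The bound `√e + 1` matters only through `U ≤ 1 < √e + 1`, which makes the limit admissible.
    · intro x hx
      have h1 : 0 < √(Real.exp 1) := Real.sqrt_pos.2 (Real.exp_pos 1)
      rw [abs_of_pos (hgpos _ hx)]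
      linarith [hg1 _ hx]
  refine ⟨U, hsol, fun V hV => hV.eqOn hα hαβ hsol, hUmem.memH1, ?_⟩
  refine convergesTo_of_isNearMinimizer hN0 hα hαβ hU
    (tendsto_lqNorm_of_profile hN0 hα hαβ hU (fun r hr => (hgpos r hr).le) hg1 hβm hgβ)
    (radialForm_self_pos hα hαβ hU.isProfile hgpos) hβ.le fun p hp u hu => ?_
  have hp0 : 0 < p := one_pos.trans hp
  obtain ⟨f, f', Q, huf, hf, hQα, hQβ⟩ :=
    exists_profile_of_solvesNeumann hN hα hαβ hp0 hu.mem_cone.1 hu.solves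
  have hfp : IsProfile α β f f' := hf.isProfile hα hαβ (Or.inr hQα)
  have h0 : ∀ r ∈ Set.Icc α β, 0 ≤ f r := fun r hr => by
    obtain ⟨x, hx, rfl⟩ := exists_mem_closedAnnulus_norm_eq hN0 hα hr
    exact huf x hx ▸ hu.mem_cone.2.1 x hx
  have hmono : MonotoneOn f (Set.Icc α β) := fun r hr s hs hrs => by
    obtain ⟨x, hx, rfl⟩ := exists_mem_closedAnnulus_norm_eq hN0 hα hr
    obtain ⟨y, hy, rfl⟩ := exists_mem_closedAnnulus_norm_eq hN0 hα hs
    rw [← huf x hx, ← huf y hy]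
    exact hu.mem_cone.2.2 x hx y hy hrs
  have hle : ∀ r ∈ Set.Icc α β, f r ≤ f β := fun r hr => hmono hr hβm hr.2
  obtain ⟨t, ht, htu, htq⟩ := hu.minimal
  have hpos : 0 < f β := by
    obtain ⟨x, hx, hne⟩ := htu.2.1
    have h1 : f ‖x‖ ≠ 0 := fun h => hne (by rw [Pi.smul_apply, huf x hx, h, smul_zero])
    exact ((h0 _ hx).lt_of_ne' h1).trans_le (hle _ hx)
  have hquot : quotientQ N α β p u ≤ quotientQ N α β p U := by
    rw [← quotientQ_smul hN0 hα hαβ hp0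
      ⟨hu.solves.solves.contDiffOn.of_le (by norm_num), huf, hfp⟩ ht, htq]
    exact csInf_le ⟨0, Set.forall_mem_image.2 fun v _ => quotientQ_nonneg v⟩ ⟨U, hUcomp, rfl⟩
  refine ⟨f, f', f β, isNearMinimizer_of_solvesNeumann hα hαβ hp0 hrad hU hgβ (Or.inl ⟨rfl, hP⟩)
    hu.solves huf hf hQα hQβ h0 hle hpos (fun r hr => ?_) hquot⟩
  -- Monotonicity turns the one-sided bound on `f'` into a bound on `|f'|`, with `C = β`.
  rw [abs_of_nonneg (hfp.deriv_nonneg_of_monotoneOn hmono r hr)]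
  exact hf.deriv_le_of_flux_left_eq_zero hα hQα hpos.le (fun s hs =>
    rhs_le_of_nonneg (h0 s (Set.Ioo_subset_Icc_self hs)) (hle s (Set.Ioo_subset_Icc_self hs))) r hr

theorem exists_limitMinus (hN : 2 ≤ N) (hα : 0 < α) (hαβ : α < β) :
    ∃ U : EuclideanSpace ℝ (Fin N) → ℝ, SolvesLimitMinus N α β U ∧
      (∀ V, SolvesLimitMinus N α β V → Set.EqOn V U (closedAnnulus N α β)) ∧
      MemH1 (annulus N α β) U ∧
      ConvergesTo N α β (fun p => {u | IsDecreasingSolution N α β p u}) U := by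
  have hN0 : 0 < N := by omega
  have hβ : 0 < β := hα.trans hαβ
  have hαm : α ∈ Set.Icc α β := ⟨le_rfl, hαβ.le⟩
  obtain ⟨g, g', P, hsol, hrad, hP, hgα, hgpos, hganti⟩ := exists_solvesLimitMinus hN hα hαβ
  set U : EuclideanSpace ℝ (Fin N) → ℝ := fun x => g ‖x‖ with hUdef
  have hU : HasProfile N α β U g g' :=
    ⟨hsol.solves.contDiffOn.of_le (by norm_num), fun _ _ => rfl,
      hrad.isProfile hα.le hαβ (Or.inl hα)⟩
  have hg1 : ∀ r ∈ Set.Icc α β, g r ≤ 1 := fun r hr => hgα ▸ hganti hαm hr hr.1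
  have hUmem : MemH1Rad N α β U := memH1Rad_of_profile hN0 hα.le hαβ hU hsol.solves.continuousOn
  have hUcomp : U ∈ decreasingCompetitors N α β := by
    refine ⟨⟨hUmem, fun x hx => (hgpos _ hx).le, fun x hx y hy hxy => hganti hx hy hxy⟩, ?_⟩
    obtain ⟨x, hx, hxα⟩ := exists_mem_closedAnnulus_norm_eq hN0 hα.le hαm
    exact ⟨x, hx, (hgpos _ hx).ne'⟩
  refine ⟨U, hsol, fun V hV => hV.eqOn hα hαβ hsol, hUmem.memH1, ?_⟩
  -- This `C` is the constant of the derivative bound obtained from the vanishing flux at `β`.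
  refine convergesTo_of_isNearMinimizer (C := β ^ (N - 1) * β / α ^ (N - 1)) hN0 hα.le hαβ hU
    (tendsto_lqNorm_of_profile hN0 hα.le hαβ hU (fun r hr => (hgpos r hr).le) hg1 hαm hgα)
    (radialForm_self_pos hα.le hαβ hU.isProfile hgpos) (by positivity) fun p hp u hu => ?_
  have hp0 : 0 < p := one_pos.trans hp
  obtain ⟨f, f', Q, huf, hf, hQα, hQβ⟩ :=
    exists_profile_of_solvesNeumann hN hα.le hαβ hp0 hu.mem_cone.1 hu.solves
  have hfp : IsProfile α β f f' := hf.isProfile hα.le hαβ (Or.inr hQα)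
  have h0 : ∀ r ∈ Set.Icc α β, 0 ≤ f r := fun r hr => by
    obtain ⟨x, hx, rfl⟩ := exists_mem_closedAnnulus_norm_eq hN0 hα.le hr
    exact huf x hx ▸ hu.mem_cone.2.1 x hx
  have hanti : AntitoneOn f (Set.Icc α β) := fun r hr s hs hrs => by
    obtain ⟨x, hx, rfl⟩ := exists_mem_closedAnnulus_norm_eq hN0 hα.le hr
    obtain ⟨y, hy, rfl⟩ := exists_mem_closedAnnulus_norm_eq hN0 hα.le hs
    rw [← huf x hx, ← huf y hy]
    exact hu.mem_cone.2.2 x hx y hy hrs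
  have hle : ∀ r ∈ Set.Icc α β, f r ≤ f α := fun r hr => hanti hαm hr hr.1
  obtain ⟨t, ht, htu, htq⟩ := hu.minimal
  have hpos : 0 < f α := by
    obtain ⟨x, hx, hne⟩ := htu.2
    have h1 : f ‖x‖ ≠ 0 := fun h => hne (by rw [Pi.smul_apply, huf x hx, h, smul_zero])
    exact ((h0 _ hx).lt_of_ne' h1).trans_le (hle _ hx)
  have hquot : quotientQ N α β p u ≤ quotientQ N α β p U := by
    rw [← quotientQ_smul hN0 hα.le hαβ hp0
      ⟨hu.solves.solves.contDiffOn.of_le (by norm_num), huf, hfp⟩ ht, htq]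
    exact csInf_le ⟨0, Set.forall_mem_image.2 fun v _ => quotientQ_nonneg v⟩ ⟨U, hUcomp, rfl⟩
  refine ⟨f, f', f α, isNearMinimizer_of_solvesNeumann hα.le hαβ hp0 hrad hU hgα
    (Or.inr ⟨rfl, hP⟩) hu.solves huf hf hQα hQβ h0 hle hpos (fun r hr => ?_) hquot⟩
  rw [abs_of_nonpos (hfp.deriv_nonpos_of_antitoneOn hanti r hr)]
  exact hf.neg_deriv_le_of_flux_right_eq_zero hα hQβ hpos.le (fun s hs =>
    rhs_le_of_nonneg (h0 s (Set.Ioo_subset_Icc_self hs)) (hle s (Set.Ioo_subset_Icc_self hs))) r hr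

end Solutions

end NeumannLayer

end

theorem mainTheorem8 (N : ℕ) (hN : 3 ≤ N) (α β : ℝ) (hα : 0 ≤ α) (hαβ : α < β) :
    (∃ U : EuclideanSpace ℝ (Fin N) → ℝ,
      NeumannLayer.SolvesLimitPlus N α β U ∧
      (∀ V, NeumannLayer.SolvesLimitPlus N α β V →
        Set.EqOn V U (NeumannLayer.closedAnnulus N α β)) ∧
      NeumannLayer.MemH1 (NeumannLayer.annulus N α β) U ∧
      NeumannLayer.ConvergesTo N α β
        (fun p => {u | NeumannLayer.IsIncreasingSolution N α β p u}) U) ∧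
    (0 < α → ∃ U : EuclideanSpace ℝ (Fin N) → ℝ,
      NeumannLayer.SolvesLimitMinus N α β U ∧
      (∀ V, NeumannLayer.SolvesLimitMinus N α β V →
        Set.EqOn V U (NeumannLayer.closedAnnulus N α β)) ∧
      NeumannLayer.MemH1 (NeumannLayer.annulus N α β) U ∧
      NeumannLayer.ConvergesTo N α β
        (fun p => {u | NeumannLayer.IsDecreasingSolution N α β p u}) U) := by
  exact ⟨NeumannLayer.exists_limitPlus (by omega) hα hαβ,
    fun hα' => NeumannLayer.exists_limitMinus (by omega) hα' hαβ⟩
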